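/- Let $M\subseteq B(H)$ be a von Neumann algebra with a faithful normal tracial state $\tau$, and let $X=(X_1,\dots,X_n)$ be self-adjoint elements of $M$. Write $\mathrm{vN}(X)\subseteq M$ for the von Neumann algebra generated by $X_1,\dots,X_n$, write $L^2(M,\tau)$ for the completion of $M$ with respect to $\langle a,b\rangle=\tau(ab^*)$, and write $\|\cdot\|_2$ for its norm. Let $\mathbb{C}\langle Z_1,\dots,Z_n\rangle$ be the algebra of non-commutative polynomials. Let $\partial_j:\mathbb{C}\langle Z_1,\dots,Z_n\rangle\to\mathbb{C}\langle Z_1,\dots,Z_n\rangle\otimes\mathbb{C}\langle Z_1,\dots,Z_n\rangle$ be the linear maps determined by $\partial_jZ_i=\delta_{i,j}\,1\otimes 1$ and $\partial_j(PQ)=(\partial_jP)(1\otimes Q)+(P\otimes 1)(\partial_jQ)$. For $P\in\mathbb{C}\langle Z_1,\dots,Z_n\rangle$ let $P(X)\in M$ be its evaluation at $X$, and let $(\partial_jP)(X)\in M\otimes M$ (algebraic tensor product) be the evaluation of $\partial_jP$ at $X$ in both tensor factors. A conjugate system for $X$ is a tuple $(\xi_1,\dots,\xi_n)$ of elements of the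 closure of $\{P(X): P\in\mathbb{C}\langle Z_1,\dots,Z_n\rangle\}$ in $L^2(M,\tau)$ such that $(\tau\otimes\tau)((\partial_jP)(X))=\tau(\xi_jP(X))$ for all $P\in\mathbb{C}\langle Z_1,\dots,Z_n\rangle$ and $j=1,\dots,n$. It is unique if it exists. The (non-microstates) free Fisher information is $\Phi^*(X_1,\dots,X_n)=\sum_{j=1}^n\|\xi_j\|_2^2$ if a conjugate system exists, and $\Phi^*(X_1,\dots,X_n)=\infty$ otherwise. Suppose that $\Phi^*(X_1,\dots,X_n)<\infty$, and let $P\in\mathbb{C}\langle Z_1,\dots,Z_n\rangle$ and $u,v\in\mathrm{vN}(X)$. If $P(X)u=0$ and $P(X)^*v=0$, then for every $i=1,\dots,n$ $$v^*\,(\partial_iP)(X)\,u=0,$$ that is, $(v^*\otimes 1)\,(\partial_iP)(X)\,(1\otimes u)=0$ in $M\otimes M$. -/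

import Mathlib

open scoped TensorProduct ENNReal ComplexOrder InnerProductSpace ComplexConjugate

namespace FreeProb

/-! ### Non-commutative polynomials and their derivatives -/

/-- The algebra `ℂ⟨Z_1, …, Z_n⟩` of non-commutative polynomials. -/
abbrev NCPoly (n : ℕ) : Type := FreeAlgebra ℂ (Fin n)

/-- The homomorphism `P ↦ [[P ⊗ 1, ∂_j P], [0, 1 ⊗ P]]` into the `2 × 2` matrices over
`ℂ⟨Z⟩ ⊗ ℂ⟨Z⟩`, given by its values on the variables. -/
noncomputable def derivHom {n : ℕ} (j : Fin n) :
    NCPoly n →ₐ[ℂ] Matrix (Fin 2) (Fin 2) (NCPoly n ⊗[ℂ] NCPoly n) :=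
  FreeAlgebra.lift ℂ fun i =>
    !![FreeAlgebra.ι ℂ i ⊗ₜ[ℂ] 1, if i = j then 1 else 0; 0, 1 ⊗ₜ[ℂ] FreeAlgebra.ι ℂ i]

/-- The non-commutative derivative `∂_j : ℂ⟨Z⟩ → ℂ⟨Z⟩ ⊗ ℂ⟨Z⟩`.  By `ncDeriv_Z` and `ncDeriv_mul`
it is the linear map with `∂_j Z_i = δ_{ij} 1 ⊗ 1` and
`∂_j (P Q) = (∂_j P) (1 ⊗ Q) + (P ⊗ 1) (∂_j Q)`. -/
noncomputable def ncDeriv {n : ℕ} (j : Fin n) : NCPoly n →ₗ[ℂ] NCPoly n ⊗[ℂ] NCPoly n where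
  toFun P := derivHom j P 0 1
  map_add' P Q := by simp
  map_smul' c P := by simp

theorem ncDeriv_Z {n : ℕ} (i j : Fin n) :
    ncDeriv j (FreeAlgebra.ι ℂ i) = if i = j then 1 ⊗ₜ[ℂ] 1 else 0 := by
  simp [ncDeriv, derivHom, Algebra.TensorProduct.one_def]

theorem derivHom_diag {n : ℕ} (j : Fin n) (P : NCPoly n) :
    derivHom j P 0 0 = P ⊗ₜ[ℂ] 1 ∧ derivHom j P 1 0 = 0 ∧ derivHom j P 1 1 = 1 ⊗ₜ[ℂ] P := by
  induction P using FreeAlgebra.induction with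
  | grade0 r =>
    simp [Algebra.algebraMap_eq_smul_one, Algebra.TensorProduct.one_def, TensorProduct.tmul_smul,
      TensorProduct.smul_tmul']
  | grade1 i => simp [derivHom]
  | mul a b ha hb =>
    simp [Matrix.mul_apply, Fin.sum_univ_two, ha, hb]
  | add a b ha hb =>
    simp [ha, hb, TensorProduct.add_tmul, TensorProduct.tmul_add]

theorem ncDeriv_mul {n : ℕ} (j : Fin n) (P Q : NCPoly n) :
    ncDeriv j (P * Q) = ncDeriv j P * (1 ⊗ₜ[ℂ] Q) + (P ⊗ₜ[ℂ] 1) * ncDeriv j Q := by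
  have hP := derivHom_diag j P
  have hQ := derivHom_diag j Q
  simp [ncDeriv, Matrix.mul_apply, Fin.sum_univ_two, hP, hQ, add_comm]

universe u

variable {H : Type u} [NormedAddCommGroup H] [InnerProductSpace ℂ H] [CompleteSpace H]

/-! ### Von Neumann algebras with a faithful normal tracial state -/

/-- The von Neumann algebra generated by a set of bounded operators: the double commutant of the
self-adjoint set `S ∪ star S`.  See `subset_vN` and `vN_le`. -/
noncomputable def vN (S : Set (H →L[ℂ] H)) : VonNeumannAlgebra H where
  toStarSubalgebra :=
    StarSubalgebra.centralizer ℂ (StarSubalgebra.centralizer ℂ S : Set (H →L[ℂ] H))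
  centralizer_centralizer' := by
    change Set.centralizer (Set.centralizer
      (StarSubalgebra.centralizer ℂ (StarSubalgebra.centralizer ℂ S : Set (H →L[ℂ] H)) :
        Set (H →L[ℂ] H))) =
      (StarSubalgebra.centralizer ℂ (StarSubalgebra.centralizer ℂ S : Set (H →L[ℂ] H)) :
        Set (H →L[ℂ] H))
    rw [StarSubalgebra.coe_centralizer_centralizer]
    simp

theorem coe_vN (S : Set (H →L[ℂ] H)) :
    (vN S : Set (H →L[ℂ] H)) = (S ∪ star S).centralizer.centralizer :=
  StarSubalgebra.coe_centralizer_centralizer (R := ℂ) S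

theorem subset_vN (S : Set (H →L[ℂ] H)) : S ⊆ (vN S : Set (H →L[ℂ] H)) := by
  rw [coe_vN]
  exact Set.subset_union_left.trans Set.subset_centralizer_centralizer

theorem vN_le {S : Set (H →L[ℂ] H)} {N : VonNeumannAlgebra H}
    (h : S ⊆ (N : Set (H →L[ℂ] H))) : vN S ≤ N := by
  have h' : S ∪ star S ⊆ (N : Set (H →L[ℂ] H)) := by
    refine Set.union_subset h fun x hx => ?_
    have hx' : star (star x) ∈ N := star_mem (h hx)
    simpa using hx'
  have h2 : (vN S : Set (H →L[ℂ] H)) ⊆ (N : Set (H →L[ℂ] H)) := by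
    rw [coe_vN, ← VonNeumannAlgebra.centralizer_centralizer N]
    exact Set.centralizer_subset (Set.centralizer_subset h')
  exact h2

/-- A faithful normal tracial state on a von Neumann algebra `M ⊆ B(H)`.  Normality is continuity
for the ultraweak topology, i.e. `τ = ∑ₖ ⟨xₖ, · yₖ⟩` with square-summable sequences of vectors. -/
structure FaithfulNormalTrace (M : VonNeumannAlgebra H) where
  /-- the underlying linear functional -/
  toLin : M.toStarSubalgebra →ₗ[ℂ] ℂ
  map_one : toLin 1 = 1
  nonneg : ∀ a, 0 ≤ toLin (star a * a)
  tracial : ∀ a b, toLin (a * b) = toLin (b * a)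
  faithful : ∀ a, toLin (star a * a) = 0 → a = 0
  normal : ∃ x y : ℕ → H, Summable (fun k => ‖x k‖ ^ 2) ∧ Summable (fun k => ‖y k‖ ^ 2) ∧
    ∀ a : M.toStarSubalgebra, HasSum (fun k => ⟪x k, (a : H →L[ℂ] H) (y k)⟫_ℂ) (toLin a)

variable {M : VonNeumannAlgebra H} (τ : FaithfulNormalTrace M)

theorem FaithfulNormalTrace.conj_star_mul (a b : M.toStarSubalgebra) :
    conj (τ.toLin (star b * a)) = τ.toLin (star a * b) := by
  have key : ∀ c, (τ.toLin (star c * c)).im = 0 := fun c => ((Complex.le_def.1 (τ.nonneg c)).2).symm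
  have h1 := key (a + b)
  have h2 := key (a + Complex.I • b)
  have ha := key a
  have hb := key b
  simp only [star_add, add_mul, mul_add, map_add, Complex.add_im, star_smul, smul_mul_assoc,
    mul_smul_comm, map_smul, smul_eq_mul, Complex.mul_im, Complex.mul_re, Complex.I_re,
    Complex.I_im, Complex.star_def, Complex.conj_I, Complex.neg_re, Complex.neg_im, ha, hb]
    at h1 h2
  apply Complex.ext
  · simp only [Complex.conj_re]; linarith
  · simp only [Complex.conj_im]; linarith

/-! ### The Hilbert space `L²(M, τ)` -/

/-- A copy of `M`, to carry the inner product `⟨a, b⟩ = τ(a* b)` (linear in `b`). -/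
@[nolint unusedArguments]
def PreL2 (_τ : FaithfulNormalTrace M) : Type u := M.toStarSubalgebra

noncomputable instance : AddCommGroup (PreL2 τ) := inferInstanceAs (AddCommGroup M.toStarSubalgebra)
noncomputable instance : Module ℂ (PreL2 τ) := inferInstanceAs (Module ℂ M.toStarSubalgebra)

/-- The identity `M → PreL2 τ`. -/
noncomputable def toPreL2 : M.toStarSubalgebra ≃ₗ[ℂ] PreL2 τ := LinearEquiv.refl ℂ _

/-- The inner product `⟨a, b⟩ = τ(a* b)` on `M`. -/
noncomputable abbrev preL2Core : PreInnerProductSpace.Core ℂ (PreL2 τ) where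
  inner a b := τ.toLin (star ((toPreL2 τ).symm a) * (toPreL2 τ).symm b)
  conj_inner_symm a b := τ.conj_star_mul _ _
  re_inner_nonneg a := (Complex.le_def.1 (τ.nonneg ((toPreL2 τ).symm a))).1
  add_left a b c := by rw [map_add, star_add, add_mul, map_add]
  smul_left a b r := by
    rw [map_smul, star_smul, smul_mul_assoc, map_smul]; rfl

noncomputable instance : SeminormedAddCommGroup (PreL2 τ) :=
  InnerProductSpace.Core.toSeminormedAddCommGroup (c := preL2Core τ)
noncomputable instance : InnerProductSpace ℂ (PreL2 τ) :=
  InnerProductSpace.ofCore (preL2Core τ)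

/-- The Hilbert space `L²(M, τ)`, the completion of `M` for the inner product of `τ`. -/
abbrev L2 : Type u := UniformSpace.Completion (PreL2 τ)

/-- The canonical map `M → L²(M, τ)`. -/
noncomputable def toL2 : M.toStarSubalgebra →ₗ[ℂ] L2 τ :=
  (UniformSpace.Completion.toComplL (𝕜 := ℂ) (E := PreL2 τ)).toLinearMap ∘ₗ
    (toPreL2 τ).toLinearMap

theorem inner_toL2 (a b : M.toStarSubalgebra) :
    ⟪toL2 τ a, toL2 τ b⟫_ℂ = τ.toLin (star a * b) :=
  UniformSpace.Completion.inner_coe _ _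

/-- The pairing `τ(ξ a)` of `ξ ∈ L²(M, τ)` with `a ∈ M`: the extension of `(b, a) ↦ τ(b a)` by
continuity in the first argument, see `pair_toL2`. -/
noncomputable def pair (ξ : L2 τ) (a : M.toStarSubalgebra) : ℂ := ⟪toL2 τ (star a), ξ⟫_ℂ

theorem pair_toL2 (a b : M.toStarSubalgebra) : pair τ (toL2 τ b) a = τ.toLin (b * a) := by
  rw [pair, inner_toL2, star_star, τ.tracial]

/-! ### Evaluation, conjugate systems and free Fisher information -/

/-- The evaluation homomorphism `P ↦ P(X)`. -/
noncomputable def ev {n : ℕ} (X : Fin n → M.toStarSubalgebra) :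
    NCPoly n →ₐ[ℂ] M.toStarSubalgebra :=
  FreeAlgebra.lift ℂ X

/-- The evaluation `Q ↦ Q(X)` on `ℂ⟨Z⟩ ⊗ ℂ⟨Z⟩`, i.e. `(P₁ ⊗ P₂)(X) = P₁(X) ⊗ P₂(X)`. -/
noncomputable def ev₂ {n : ℕ} (X : Fin n → M.toStarSubalgebra) :
    NCPoly n ⊗[ℂ] NCPoly n →ₐ[ℂ] M.toStarSubalgebra ⊗[ℂ] M.toStarSubalgebra :=
  Algebra.TensorProduct.map (ev X) (ev X)

/-- The functional `τ ⊗ τ` on the algebraic tensor product `M ⊗ M`. -/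
noncomputable def FaithfulNormalTrace.tensor :
    M.toStarSubalgebra ⊗[ℂ] M.toStarSubalgebra →ₗ[ℂ] ℂ :=
  LinearMap.mul' ℂ ℂ ∘ₗ TensorProduct.map τ.toLin τ.toLin

theorem FaithfulNormalTrace.tensor_tmul (a b : M.toStarSubalgebra) :
    τ.tensor (a ⊗ₜ[ℂ] b) = τ.toLin a * τ.toLin b := by
  simp [FaithfulNormalTrace.tensor]

/-- `L²(X_1, …, X_n, τ)`: the closure in `L²(M, τ)` of the polynomials in `X_1, …, X_n`. -/
noncomputable def L2gen {n : ℕ} (X : Fin n → M.toStarSubalgebra) : Submodule ℂ (L2 τ) :=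
  (LinearMap.range (toL2 τ ∘ₗ (ev X).toLinearMap)).topologicalClosure

/-- `ξ` satisfies the conjugate relations for `X`. -/
def ConjugateRelations {n : ℕ} (X : Fin n → M.toStarSubalgebra) (ξ : Fin n → L2 τ) : Prop :=
  ∀ (j : Fin n) (P : NCPoly n), τ.tensor (ev₂ X (ncDeriv j P)) = pair τ (ξ j) (ev X P)

/-- `ξ` is the conjugate system for `X`. -/
def IsConjugateSystem {n : ℕ} (X : Fin n → M.toStarSubalgebra) (ξ : Fin n → L2 τ) : Prop :=
  ConjugateRelations τ X ξ ∧ ∀ j, ξ j ∈ L2gen τ X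

theorem exists_ev_eq_star {n : ℕ} {X : Fin n → M.toStarSubalgebra}
    (hX : ∀ i, IsSelfAdjoint (X i)) (P : NCPoly n) : ∃ Q, ev X Q = star (ev X P) := by
  induction P using FreeAlgebra.induction with
  | grade0 r => exact ⟨algebraMap _ _ (star r), by simp [Algebra.algebraMap_eq_smul_one]⟩
  | grade1 i => exact ⟨FreeAlgebra.ι ℂ i, by simp [ev, (hX i).star_eq]⟩
  | mul a b ha hb =>
    obtain ⟨p, hp⟩ := ha
    obtain ⟨q, hq⟩ := hb
    exact ⟨q * p, by simp [hp, hq]⟩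
  | add a b ha hb =>
    obtain ⟨p, hp⟩ := ha
    obtain ⟨q, hq⟩ := hb
    exact ⟨p + q, by simp [hp, hq]⟩

theorem IsConjugateSystem.unique {n : ℕ} {X : Fin n → M.toStarSubalgebra}
    (hX : ∀ i, IsSelfAdjoint (X i)) {ξ η : Fin n → L2 τ}
    (hξ : IsConjugateSystem τ X ξ) (hη : IsConjugateSystem τ X η) : ξ = η := by
  funext j
  have hmem : ξ j - η j ∈ L2gen τ X := sub_mem (hξ.2 j) (hη.2 j)
  have horth : ξ j - η j ∈ (L2gen τ X)ᗮ := by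
    rw [L2gen, Submodule.orthogonal_closure, Submodule.mem_orthogonal]
    rintro _ ⟨P, rfl⟩
    obtain ⟨Q, hQ⟩ := exists_ev_eq_star hX P
    have h := (hξ.1 j Q).symm.trans (hη.1 j Q)
    rw [pair, pair, hQ, star_star] at h
    rw [inner_sub_right, sub_eq_zero]
    exact h
  exact sub_eq_zero.1 (Submodule.disjoint_def.1 (L2gen τ X).orthogonal_disjoint _ hmem horth)

open Classical in
/-- The non-microstates free Fisher information `Φ*(X_1, …, X_n)`: it is `∑ⱼ ‖ξⱼ‖₂²` for the
conjugate system `ξ` (see `IsConjugateSystem.unique`), and `∞` if there is none. -/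
noncomputable def freeFisherInfo {n : ℕ} (X : Fin n → M.toStarSubalgebra) : ℝ≥0∞ :=
  if h : ∃ ξ : Fin n → L2 τ, IsConjugateSystem τ X ξ then ∑ j, ‖h.choose j‖ₑ ^ 2 else ⊤

theorem freeFisherInfo_eq {n : ℕ} {X : Fin n → M.toStarSubalgebra}
    (hX : ∀ i, IsSelfAdjoint (X i)) {ξ : Fin n → L2 τ} (hξ : IsConjugateSystem τ X ξ) :
    freeFisherInfo τ X = ∑ j, ‖ξ j‖ₑ ^ 2 := by
  have h : ∃ ξ : Fin n → L2 τ, IsConjugateSystem τ X ξ := ⟨ξ, hξ⟩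
  rw [freeFisherInfo, dif_pos h, IsConjugateSystem.unique τ hX h.choose_spec hξ]

end FreeProb

namespace FreeProb

universe u

variable {H : Type u} [NormedAddCommGroup H] [InnerProductSpace ℂ H] [CompleteSpace H]
variable {M : VonNeumannAlgebra H} (τ : FaithfulNormalTrace M)

/-! Write `W`, `P`, `U` also for values at `X`. The conjugate relation for `W P U`, expanded by the
Leibniz rule, reads `τ(ξ W P U) = (τ⊗τ)(∂W (1⊗PU)) + (τ⊗τ)((W⊗1) ∂P (1⊗U)) + (τ⊗τ)((WP⊗1) ∂U)`. If
`W` and `U` are bounded in operator norm and `‖W P‖₂`, `‖P U‖₂` are small, the middle term is small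
provided the slices `(τ⊗id)(∂W)` and `(id⊗τ)(∂U)` are controlled in `‖·‖₂` by operator norms.

That control (`norm_derivRight_le`, `norm_derivLeft_le`) is the analytic core. The vectors `∂*(P⊗1)
= Pξ - (id⊗τ)(∂P)` satisfy `⟨∂*(Q⊗1), ∂*(PR⊗1)⟩ = ⟨∂*(P*Q⊗1), ∂*(R⊗1)⟩` by coassociativity of `∂`.
Hence `‖∂*(P⊗1)‖² ≤ ‖ξ‖ ‖∂*(P*P⊗1)‖`. Iterating on powers of `P*P`, as in the spectral radius
formula, gives `‖∂*(P⊗1)‖ ≤ ‖ξ‖ ‖P‖` (`norm_derivAdjoint_le`).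

A form of Kaplansky density (`boundedlyApproximable`) then replaces `W`, `U` by elements `w`, `u` of
`vN(X)` with `wP = 0 = Pu`, so that `(τ⊗τ)((w⊗1) ∂P (1⊗u)) = 0` (`derivTrace_eq_zero`). These
annihilators remain such after multiplying `w` on the left and `u` on the right by elements of
`vN(X)`. Faithfulness of `τ`, one tensor factor at a time, turns the vanishing traces into the
vanishing tensor. -/

/-! ### Norm estimates and left multiplication on `L²(M, τ)`. -/

theorem isClosed_vonNeumannAlgebra (N : VonNeumannAlgebra H) :
    IsClosed (N : Set (H →L[ℂ] H)) := by
  rw [← N.centralizer_centralizer]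
  exact Set.isClosed_centralizer _

theorem cfc_mem_vonNeumannAlgebra (N : VonNeumannAlgebra H) {a : H →L[ℂ] H} (ha : a ∈ N)
    (f : ℝ → ℝ) : cfc f a ∈ N := by
  exact cfc_mem (𝕜' := ℂ) (s := N.toStarSubalgebra) (hs := isClosed_vonNeumannAlgebra N) f ha

theorem norm_toL2_sq (a : M.toStarSubalgebra) :
    ((‖toL2 τ a‖ ^ 2 : ℝ) : ℂ) = τ.toLin (star a * a) := by
  rw [← inner_toL2, inner_self_eq_norm_sq_to_K]; norm_cast

theorem norm_toL2_star (a : M.toStarSubalgebra) : ‖toL2 τ (star a)‖ = ‖toL2 τ a‖ := by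
  have h : ((‖toL2 τ (star a)‖ ^ 2 : ℝ) : ℂ) = ((‖toL2 τ a‖ ^ 2 : ℝ) : ℂ) := by
    rw [norm_toL2_sq, norm_toL2_sq, star_star, τ.tracial]
  have h' := Complex.ofReal_injective h
  exact (sq_eq_sq₀ (norm_nonneg _) (norm_nonneg _)).1 h'

theorem norm_trace_mul_le (a b : M.toStarSubalgebra) :
    ‖τ.toLin (a * b)‖ ≤ ‖toL2 τ a‖ * ‖toL2 τ b‖ := by
  have := norm_inner_le_norm (𝕜 := ℂ) (toL2 τ (star a)) (toL2 τ b)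
  rwa [inner_toL2, star_star, norm_toL2_star] at this

theorem norm_toL2_mul_le (a b : M.toStarSubalgebra) :
    ‖toL2 τ (a * b)‖ ≤ ‖a‖ * ‖toL2 τ b‖ := by
  -- With `c = (‖a‖² - a*a)^{1/2}`, the inequality is `τ((cb)*(cb)) ≥ 0`. The functional calculus
  -- keeps `c` in `M`.
  obtain ⟨c, hc⟩ : ∃ c : M.toStarSubalgebra,
      star a * a + star c * c = ((‖a‖ ^ 2 : ℝ) : ℂ) • (1 : M.toStarSubalgebra) := by
    set s : H →L[ℂ] H := star (a : H →L[ℂ] H) * a with hs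
    have hsM : s ∈ M := mul_mem (star_mem a.2) a.2
    have hsa : IsSelfAdjoint s := IsSelfAdjoint.star_mul_self _
    have hsn : ‖s‖ = ‖a‖ ^ 2 := by
      rw [hs, CStarRing.norm_star_mul_self, sq]; rfl
    let f : ℝ → ℝ := fun t => Real.sqrt (‖a‖ ^ 2 - t)
    have hf : Continuous f := by fun_prop
    refine ⟨⟨cfc f s, cfc_mem_vonNeumannAlgebra M hsM f⟩, ?_⟩
    apply Subtype.ext
    change s + star (cfc f s) * cfc f s = ((‖a‖ ^ 2 : ℝ) : ℂ) • (1 : H →L[ℂ] H)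
    have h1 : star (cfc f s) = cfc f s := (cfc_predicate f s : IsSelfAdjoint _).star_eq
    rw [h1, ← cfc_mul f f s hf.continuousOn hf.continuousOn]
    nth_rw 1 [← cfc_id' ℝ s hsa]
    rw [← cfc_add (R := ℝ) (f := fun x => x) (g := fun x => f x * f x) (a := s) (by fun_prop)
      (by fun_prop)]
    rw [cfc_congr (g := fun _ => ‖a‖ ^ 2), cfc_const _ _ hsa]
    · rw [Algebra.algebraMap_eq_smul_one, Complex.coe_smul]
    · intro t ht
      have : |t| ≤ ‖a‖ ^ 2 := by
        rw [← hsn]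
        refine (spectrum.norm_le_norm_mul_of_mem ht).trans ?_
        exact mul_le_of_le_one_right (norm_nonneg _) ContinuousLinearMap.norm_id_le
      have h3 : 0 ≤ ‖a‖ ^ 2 - t := by linarith [le_abs_self t]
      simp only [f]
      rw [Real.mul_self_sqrt h3]; ring
  have h1 : τ.toLin (star (a * b) * (a * b)) + τ.toLin (star (c * b) * (c * b))
      = ((‖a‖ ^ 2 : ℝ) : ℂ) * τ.toLin (star b * b) := by
    rw [← map_add, ← smul_eq_mul (_ : ℂ) (τ.toLin _), ← map_smul]
    congr 1
    calc _ = star b * (star a * a + star c * c) * b := by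
          simp only [star_mul]; noncomm_ring
      _ = _ := by rw [hc]; simp
  rw [← norm_toL2_sq, ← norm_toL2_sq, ← norm_toL2_sq] at h1
  have h2 : ‖toL2 τ (a * b)‖ ^ 2 + ‖toL2 τ (c * b)‖ ^ 2 = ‖a‖ ^ 2 * ‖toL2 τ b‖ ^ 2 := by
    exact_mod_cast h1
  have h3 : ‖toL2 τ (a * b)‖ ^ 2 ≤ (‖a‖ * ‖toL2 τ b‖) ^ 2 := by
    rw [mul_pow]; nlinarith [sq_nonneg ‖toL2 τ (c * b)‖]
  exact (sq_le_sq₀ (norm_nonneg _) (by positivity)).1 h3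

theorem norm_coe_star (a : M.toStarSubalgebra) : ‖star a‖ = ‖a‖ :=
  norm_star (a : H →L[ℂ] H)

theorem norm_toL2_mul_le' (a b : M.toStarSubalgebra) :
    ‖toL2 τ (a * b)‖ ≤ ‖toL2 τ a‖ * ‖b‖ := by
  rw [← norm_toL2_star, star_mul, mul_comm, ← norm_toL2_star τ a, ← norm_coe_star b]
  exact norm_toL2_mul_le τ _ _

theorem norm_toL2_one : ‖toL2 τ 1‖ = 1 := by
  have := norm_toL2_sq τ 1
  rw [star_one, one_mul, τ.map_one] at this
  have h : ‖toL2 τ 1‖ ^ 2 = 1 := by exact_mod_cast this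
  exact (pow_eq_one_iff_of_nonneg (norm_nonneg _) two_ne_zero).1 h

theorem norm_toL2_le (a : M.toStarSubalgebra) : ‖toL2 τ a‖ ≤ ‖a‖ := by
  simpa [norm_toL2_one] using norm_toL2_mul_le τ a 1

theorem denseRange_toL2 : DenseRange (toL2 τ) :=
  UniformSpace.Completion.denseRange_coe (α := PreL2 τ)

/-- Left multiplication by `a ∈ M` on `L²(M, τ)`. -/
noncomputable def leftMul (a : M.toStarSubalgebra) : L2 τ →L[ℂ] L2 τ :=
  ContinuousLinearMap.completion
    (LinearMap.mkContinuous
      ((toPreL2 τ).toLinearMap ∘ₗ LinearMap.mulLeft ℂ a ∘ₗ (toPreL2 τ).symm.toLinearMap) ‖a‖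
      fun x => by
        have := norm_toL2_mul_le τ a ((toPreL2 τ).symm x)
        simpa [toL2, UniformSpace.Completion.norm_coe] using this)

theorem leftMul_toL2 (a b : M.toStarSubalgebra) : leftMul τ a (toL2 τ b) = toL2 τ (a * b) := by
  simp [leftMul, toL2]

theorem norm_leftMul_le (a : M.toStarSubalgebra) (η : L2 τ) :
    ‖leftMul τ a η‖ ≤ ‖a‖ * ‖η‖ := by
  refine (denseRange_toL2 τ).induction_on (p := fun η => ‖leftMul τ a η‖ ≤ ‖a‖ * ‖η‖) η
    (isClosed_le (by fun_prop) (by fun_prop)) fun b => ?_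
  rw [leftMul_toL2]; exact norm_toL2_mul_le τ a b

theorem leftMul_mul (a b : M.toStarSubalgebra) (η : L2 τ) :
    leftMul τ (a * b) η = leftMul τ a (leftMul τ b η) := by
  refine (denseRange_toL2 τ).induction_on
    (p := fun η => leftMul τ (a * b) η = leftMul τ a (leftMul τ b η)) η
    (isClosed_eq (by fun_prop) (by fun_prop)) fun c => ?_
  simp only [leftMul_toL2, mul_assoc]

theorem leftMul_one (η : L2 τ) : leftMul τ 1 η = η := by
  refine (denseRange_toL2 τ).induction_on (p := fun η => leftMul τ 1 η = η) η
    (isClosed_eq (by fun_prop) (by fun_prop)) fun c => ?_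
  simp only [leftMul_toL2, one_mul]

theorem inner_leftMul_left (a : M.toStarSubalgebra) (η ζ : L2 τ) :
    ⟪leftMul τ a η, ζ⟫_ℂ = ⟪η, leftMul τ (star a) ζ⟫_ℂ := by
  refine (denseRange_toL2 τ).induction_on₂
    (p := fun η ζ => ⟪leftMul τ a η, ζ⟫_ℂ = ⟪η, leftMul τ (star a) ζ⟫_ℂ)
    (isClosed_eq (by fun_prop) (by fun_prop)) (fun b c => ?_) η ζ
  simp only [leftMul_toL2, inner_toL2, star_mul, mul_assoc]

/-! ### Slices of the non-commutative derivative. -/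

section Derivations
variable {n : ℕ} (X : Fin n → M.toStarSubalgebra) (j : Fin n)

/-- The slice map `p ⊗ q ↦ τ(q(X) d) p`. -/
noncomputable def sliceRight (d : M.toStarSubalgebra) : NCPoly n ⊗[ℂ] NCPoly n →ₗ[ℂ] NCPoly n :=
  (TensorProduct.rid ℂ (NCPoly n)).toLinearMap ∘ₗ
    LinearMap.lTensor (NCPoly n) (τ.toLin ∘ₗ LinearMap.mulRight ℂ d ∘ₗ (ev X).toLinearMap)

/-- The slice map `p ⊗ q ↦ τ(c p(X)) q`. -/
noncomputable def sliceLeft (c : M.toStarSubalgebra) : NCPoly n ⊗[ℂ] NCPoly n →ₗ[ℂ] NCPoly n :=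
  (TensorProduct.lid ℂ (NCPoly n)).toLinearMap ∘ₗ
    LinearMap.rTensor (NCPoly n) (τ.toLin ∘ₗ LinearMap.mulLeft ℂ c ∘ₗ (ev X).toLinearMap)

/-- `(id ⊗ τ)((∂_j P) (1 ⊗ d))`, where only the second tensor factor is evaluated. -/
noncomputable def derivRight (P : NCPoly n) (d : M.toStarSubalgebra) : NCPoly n :=
  sliceRight τ X d (ncDeriv j P)

/-- `(τ ⊗ id)((c ⊗ 1) (∂_j P))`, where only the first tensor factor is evaluated. -/
noncomputable def derivLeft (c : M.toStarSubalgebra) (P : NCPoly n) : NCPoly n :=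
  sliceLeft τ X c (ncDeriv j P)

/-- `(τ ⊗ τ)((c ⊗ 1) (∂_j P)(X) (1 ⊗ d))`. -/
noncomputable def derivTrace (c : M.toStarSubalgebra) (P : NCPoly n) (d : M.toStarSubalgebra) : ℂ :=
  τ.tensor ((c ⊗ₜ[ℂ] 1) * ev₂ X (ncDeriv j P) * (1 ⊗ₜ[ℂ] d))

theorem sliceRight_tmul (d : M.toStarSubalgebra) (p q : NCPoly n) :
    sliceRight τ X d (p ⊗ₜ q) = τ.toLin (ev X q * d) • p := by
  simp [sliceRight]

theorem sliceLeft_tmul (c : M.toStarSubalgebra) (p q : NCPoly n) :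
    sliceLeft τ X c (p ⊗ₜ q) = τ.toLin (c * ev X p) • q := by
  simp [sliceLeft]

theorem ev₂_tmul (p q : NCPoly n) : ev₂ X (p ⊗ₜ q) = ev X p ⊗ₜ ev X q := by
  simp [ev₂]

theorem tensor_eq_sliceRight (c d : M.toStarSubalgebra) (t : NCPoly n ⊗[ℂ] NCPoly n) :
    τ.tensor ((c ⊗ₜ[ℂ] 1) * ev₂ X t * (1 ⊗ₜ[ℂ] d)) = τ.toLin (c * ev X (sliceRight τ X d t)) := by
  induction t using TensorProduct.induction_on with
  | zero => simp
  | tmul p q =>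
    simp [ev₂_tmul, sliceRight_tmul, FaithfulNormalTrace.tensor_tmul, mul_comm]
  | add a b ha hb => simp only [map_add, mul_add, add_mul, ha, hb]

theorem tensor_eq_sliceLeft (c d : M.toStarSubalgebra) (t : NCPoly n ⊗[ℂ] NCPoly n) :
    τ.tensor ((c ⊗ₜ[ℂ] 1) * ev₂ X t * (1 ⊗ₜ[ℂ] d)) = τ.toLin (ev X (sliceLeft τ X c t) * d) := by
  induction t using TensorProduct.induction_on with
  | zero => simp
  | tmul p q =>
    simp [ev₂_tmul, sliceLeft_tmul, FaithfulNormalTrace.tensor_tmul]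
  | add a b ha hb => simp only [map_add, mul_add, add_mul, ha, hb]

theorem sliceRight_mul_right (d : M.toStarSubalgebra) (Q : NCPoly n)
    (t : NCPoly n ⊗[ℂ] NCPoly n) :
    sliceRight τ X d (t * (1 ⊗ₜ Q)) = sliceRight τ X (ev X Q * d) t := by
  induction t using TensorProduct.induction_on with
  | zero => simp
  | tmul p q => simp [sliceRight_tmul, mul_assoc]
  | add a b ha hb => simp only [map_add, add_mul, ha, hb]

theorem sliceRight_mul_left (d : M.toStarSubalgebra) (P : NCPoly n)
    (t : NCPoly n ⊗[ℂ] NCPoly n) :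
    sliceRight τ X d ((P ⊗ₜ 1) * t) = P * sliceRight τ X d t := by
  induction t using TensorProduct.induction_on with
  | zero => simp
  | tmul p q => simp [sliceRight_tmul]
  | add a b ha hb => simp only [map_add, mul_add, ha, hb]

theorem sliceLeft_mul_right (c : M.toStarSubalgebra) (Q : NCPoly n)
    (t : NCPoly n ⊗[ℂ] NCPoly n) :
    sliceLeft τ X c (t * (1 ⊗ₜ Q)) = sliceLeft τ X c t * Q := by
  induction t using TensorProduct.induction_on with
  | zero => simp
  | tmul p q => simp [sliceLeft_tmul]
  | add a b ha hb => simp only [map_add, add_mul, ha, hb]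

theorem sliceLeft_mul_left (c : M.toStarSubalgebra) (P : NCPoly n)
    (t : NCPoly n ⊗[ℂ] NCPoly n) :
    sliceLeft τ X c ((P ⊗ₜ 1) * t) = sliceLeft τ X (c * ev X P) t := by
  induction t using TensorProduct.induction_on with
  | zero => simp
  | tmul p q => simp [sliceLeft_tmul, mul_assoc]
  | add a b ha hb => simp only [map_add, mul_add, ha, hb]

theorem derivTrace_eq_right (c : M.toStarSubalgebra) (P : NCPoly n) (d : M.toStarSubalgebra) :
    derivTrace τ X j c P d = τ.toLin (c * ev X (derivRight τ X j P d)) :=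
  tensor_eq_sliceRight τ X c d _

theorem derivTrace_eq_left (c : M.toStarSubalgebra) (P : NCPoly n) (d : M.toStarSubalgebra) :
    derivTrace τ X j c P d = τ.toLin (ev X (derivLeft τ X j c P) * d) :=
  tensor_eq_sliceLeft τ X c d _

theorem derivRight_mul (A B : NCPoly n) (d : M.toStarSubalgebra) :
    derivRight τ X j (A * B) d = derivRight τ X j A (ev X B * d) + A * derivRight τ X j B d := by
  simp only [derivRight, ncDeriv_mul, map_add, sliceRight_mul_right, sliceRight_mul_left]

theorem derivLeft_mul (c : M.toStarSubalgebra) (A B : NCPoly n) :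
    derivLeft τ X j c (A * B) = derivLeft τ X j c A * B + derivLeft τ X j (c * ev X A) B := by
  simp only [derivLeft, ncDeriv_mul, map_add, sliceLeft_mul_right, sliceLeft_mul_left]

theorem derivTrace_mul (c : M.toStarSubalgebra) (A B : NCPoly n) (d : M.toStarSubalgebra) :
    derivTrace τ X j c (A * B) d =
      derivTrace τ X j c A (ev X B * d) + derivTrace τ X j (c * ev X A) B d := by
  simp only [derivTrace_eq_right, derivRight_mul, map_add, mul_add, map_mul, mul_assoc]

theorem derivTrace_add (c : M.toStarSubalgebra) (A B : NCPoly n) (d : M.toStarSubalgebra) :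
    derivTrace τ X j c (A + B) d = derivTrace τ X j c A d + derivTrace τ X j c B d := by
  simp [derivTrace, mul_add, add_mul]

theorem derivTrace_sub_left (c c' : M.toStarSubalgebra) (P : NCPoly n) (d : M.toStarSubalgebra) :
    derivTrace τ X j (c - c') P d = derivTrace τ X j c P d - derivTrace τ X j c' P d := by
  simp only [derivTrace_eq_right, sub_mul, map_sub]

theorem derivTrace_sub_right (c : M.toStarSubalgebra) (P : NCPoly n) (d d' : M.toStarSubalgebra) :
    derivTrace τ X j c P (d - d') = derivTrace τ X j c P d - derivTrace τ X j c P d' := by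
  simp only [derivTrace_eq_left, mul_sub, map_sub]

theorem ncDeriv_algebraMap (r : ℂ) : ncDeriv j (algebraMap ℂ (NCPoly n) r) = 0 := by
  have h1 : ncDeriv j (1 : NCPoly n) = 0 := by
    simp [ncDeriv]
  rw [Algebra.algebraMap_eq_smul_one, map_smul, h1, smul_zero]

theorem derivTrace_algebraMap (c d : M.toStarSubalgebra) (r : ℂ) :
    derivTrace τ X j c (algebraMap ℂ (NCPoly n) r) d = 0 := by
  simp [derivTrace, ncDeriv_algebraMap]

theorem derivTrace_ι (c d : M.toStarSubalgebra) (i : Fin n) :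
    derivTrace τ X j c (FreeAlgebra.ι ℂ i) d = if i = j then τ.toLin c * τ.toLin d else 0 := by
  rw [derivTrace, ncDeriv_Z]
  split_ifs <;> simp [ev₂_tmul, FaithfulNormalTrace.tensor_tmul]

/-- Coassociativity of `∂_j`, paired with `τ(c ·) ⊗ τ ⊗ τ(· d)`. -/
theorem derivTrace_coassoc (P : NCPoly n) (c d : M.toStarSubalgebra) :
    derivTrace τ X j c (derivRight τ X j P d) 1 = derivTrace τ X j 1 (derivLeft τ X j c P) d := by
  induction P using FreeAlgebra.induction generalizing c d with
  | grade0 r => simp [derivTrace, derivRight, derivLeft, ncDeriv_algebraMap]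
  | grade1 i =>
    rw [derivRight, derivLeft, ncDeriv_Z]
    split_ifs
    · rw [sliceRight_tmul, sliceLeft_tmul, ← Algebra.algebraMap_eq_smul_one,
        ← Algebra.algebraMap_eq_smul_one, derivTrace_algebraMap, derivTrace_algebraMap]
    · simp [derivTrace]
  -- Both sides expand into three terms. The outer ones agree by induction, with `d` replaced by
  -- `b(X) d` or `c` by `c a(X)`; the middle ones both equal the trace of the left slice of `a`
  -- times the right slice of `b`.
  | mul a b ha hb =>
    rw [derivRight_mul, derivLeft_mul, derivTrace_add, derivTrace_add, derivTrace_mul,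
      derivTrace_mul, ha, hb, mul_one, one_mul, derivTrace_eq_left τ X j c a,
      derivTrace_eq_right τ X j _ b d, add_assoc]
  | add a b ha hb =>
    simp only [derivRight, derivLeft, map_add, derivTrace_add] at ha hb ⊢
    rw [ha, hb]

/-- `Q` behaves as the adjoint of `P` under evaluation of `P` and of `∂_j P`. -/
def IsAdj (P Q : NCPoly n) : Prop :=
  ev X Q = star (ev X P) ∧
    ∀ c d, derivTrace τ X j c Q d = conj (derivTrace τ X j (star d) P (star c))

theorem trace_star (a : M.toStarSubalgebra) : τ.toLin (star a) = conj (τ.toLin a) := by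
  have := τ.conj_star_mul a 1
  simpa using this.symm

variable {τ X j}

theorem IsAdj.symm {P Q : NCPoly n} (h : IsAdj τ X j P Q) : IsAdj τ X j Q P :=
  ⟨by rw [h.1, star_star], fun c d => by rw [h.2]; simp⟩

theorem IsAdj.mul {P Q P' Q' : NCPoly n} (h : IsAdj τ X j P Q) (h' : IsAdj τ X j P' Q') :
    IsAdj τ X j (P * P') (Q' * Q) := by
  refine ⟨by simp [h.1, h'.1], fun c d => ?_⟩
  rw [derivTrace_mul, derivTrace_mul, h'.2, h.2, h.1, h'.1]
  simp [add_comm]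

theorem isAdj_one : IsAdj τ X j 1 1 := by
  refine ⟨by simp, fun c d => ?_⟩
  rw [← map_one (algebraMap ℂ (NCPoly n)), derivTrace_algebraMap, derivTrace_algebraMap]
  simp

theorem IsAdj.pow {R : NCPoly n} (h : IsAdj τ X j R R) (m : ℕ) : IsAdj τ X j (R ^ m) (R ^ m) := by
  induction m with
  | zero => simpa using isAdj_one
  | succ m ih =>
    have := h.mul ih
    rwa [← pow_succ', ← pow_succ] at this

variable (τ j) in
theorem exists_isAdj (hX : ∀ i, IsSelfAdjoint (X i)) (P : NCPoly n) : ∃ Q, IsAdj τ X j P Q := by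
  induction P using FreeAlgebra.induction with
  | grade0 r =>
    refine ⟨algebraMap _ _ (star r), by simp [Algebra.algebraMap_eq_smul_one], fun c d => ?_⟩
    rw [derivTrace_algebraMap, derivTrace_algebraMap, map_zero]
  | grade1 i =>
    refine ⟨FreeAlgebra.ι ℂ i, by simp [ev, (hX i).star_eq], fun c d => ?_⟩
    rw [derivTrace_ι, derivTrace_ι, trace_star, trace_star]
    split_ifs <;> simp [mul_comm]
  | mul a b ha hb =>
    obtain ⟨p, hp⟩ := ha
    obtain ⟨q, hq⟩ := hb
    exact ⟨q * p, hp.mul hq⟩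
  | add a b ha hb =>
    obtain ⟨p, hp⟩ := ha
    obtain ⟨q, hq⟩ := hb
    exact ⟨p + q, by simp [hp.1, hq.1], fun c d => by
      simp only [derivTrace_add, hp.2, hq.2, map_add]⟩

theorem eq_of_trace_mul_eq {a b : M.toStarSubalgebra}
    (h : ∀ c, τ.toLin (c * a) = τ.toLin (c * b)) : a = b := by
  refine sub_eq_zero.1 (τ.faithful _ ?_)
  rw [mul_sub, map_sub, h, sub_self]

/-- Taking adjoints interchanges the two tensor factors of `∂_j P`, so estimates on right slices
carry over to left slices. -/
theorem IsAdj.star_derivLeft {P Q : NCPoly n} (h : IsAdj τ X j P Q) (c : M.toStarSubalgebra) :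
    star (ev X (derivLeft τ X j c P)) = ev X (derivRight τ X j Q (star c)) := by
  refine eq_of_trace_mul_eq (τ := τ) fun d => ?_
  rw [← derivTrace_eq_right, h.2, star_star, derivTrace_eq_left, ← trace_star, star_mul, star_star]

end Derivations

/-! ### The conjugate variable and boundedness of the slices. -/

section ConjugateVariable
variable {n : ℕ} (X : Fin n → M.toStarSubalgebra) (j : Fin n)

/-- `ξ` satisfies the `j`-th conjugate relation. -/
def IsConjugateVariable (ξ : L2 τ) : Prop :=
  ∀ P : NCPoly n, τ.tensor (ev₂ X (ncDeriv j P)) = pair τ ξ (ev X P)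

/-- The vector `∂_j^*(P ⊗ 1) = P(X) ξ - (id ⊗ τ)((∂_j P)(X))`. -/
noncomputable def derivAdjoint (ξ : L2 τ) (P : NCPoly n) : L2 τ :=
  leftMul τ (ev X P) ξ - toL2 τ (ev X (derivRight τ X j P 1))

variable {τ X j} {ξ : L2 τ}

theorem IsConjugateVariable.derivTrace_one (hξ : IsConjugateVariable τ X j ξ) (P : NCPoly n) :
    derivTrace τ X j 1 P 1 = ⟪toL2 τ (star (ev X P)), ξ⟫_ℂ := by
  rw [← pair, ← hξ P, derivTrace, ← Algebra.TensorProduct.one_def, one_mul, mul_one]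

theorem derivAdjoint_mul (P Q : NCPoly n) :
    derivAdjoint τ X j ξ (P * Q) =
      leftMul τ (ev X P) (derivAdjoint τ X j ξ Q) - toL2 τ (ev X (derivRight τ X j P (ev X Q))) := by
  simp only [derivAdjoint, derivRight_mul, map_mul, leftMul_mul, map_add, map_sub, leftMul_toL2,
    mul_one]
  abel

theorem derivAdjoint_one : derivAdjoint τ X j ξ 1 = ξ := by
  have h : derivRight τ X j (1 : NCPoly n) 1 = 0 := by
    rw [derivRight, ← map_one (algebraMap ℂ (NCPoly n)), ncDeriv_algebraMap, map_zero]
  simp [derivAdjoint, h, leftMul_one]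

/-- This is the conjugate relation for `P Q` after the Leibniz rule: the term containing `∂_j Q` is
exactly what `derivAdjoint` subtracts. -/
theorem inner_star_derivAdjoint (hξ : IsConjugateVariable τ X j ξ) (P Q : NCPoly n) :
    ⟪toL2 τ (star (ev X P)), derivAdjoint τ X j ξ Q⟫_ℂ = derivTrace τ X j 1 P (ev X Q) := by
  have h1 := hξ.derivTrace_one (P * Q)
  rw [derivTrace_mul, mul_one, one_mul, derivTrace_eq_right _ _ _ (ev X P)] at h1
  rw [derivAdjoint, inner_sub_right, inner_toL2, star_star, eq_comm, eq_sub_iff_add_eq, h1,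
    map_mul, star_mul, ← leftMul_toL2, inner_leftMul_left, star_star]

theorem inner_derivAdjoint (hX : ∀ i, IsSelfAdjoint (X i)) (hξ : IsConjugateVariable τ X j ξ)
    (P Q : NCPoly n) :
    ⟪derivAdjoint τ X j ξ Q, toL2 τ (ev X P)⟫_ℂ = derivTrace τ X j (star (ev X Q)) P 1 := by
  obtain ⟨P', hP⟩ := exists_isAdj τ j hX P
  rw [← inner_conj_symm, ← star_star (ev X P), ← hP.1, inner_star_derivAdjoint hξ, hP.2]
  simp

/-- Moving `P` across the inner product by `derivAdjoint_mul` leaves one error term on each side.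
Each is a second-order slice of `∂_j P`, and coassociativity identifies them. -/
theorem inner_derivAdjoint_mul (hX : ∀ i, IsSelfAdjoint (X i)) (hξ : IsConjugateVariable τ X j ξ)
    {P P' : NCPoly n} (hP : IsAdj τ X j P P') (Q R : NCPoly n) :
    ⟪derivAdjoint τ X j ξ Q, derivAdjoint τ X j ξ (P * R)⟫_ℂ =
      ⟪derivAdjoint τ X j ξ (P' * Q), derivAdjoint τ X j ξ R⟫_ℂ := by
  rw [derivAdjoint_mul, derivAdjoint_mul, inner_sub_right, inner_sub_left, inner_leftMul_left,
    hP.1, star_star, inner_derivAdjoint hX hξ, derivTrace_coassoc, ← inner_star_derivAdjoint hξ,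
    hP.star_derivLeft, star_star]

/-- Cauchy–Schwarz against `∂*(1⊗1) = ξ`, after moving `P'` across the inner product. -/
theorem norm_derivAdjoint_sq_le (hX : ∀ i, IsSelfAdjoint (X i)) (hξ : IsConjugateVariable τ X j ξ)
    {P P' : NCPoly n} (hP : IsAdj τ X j P P') :
    ‖derivAdjoint τ X j ξ P‖ ^ 2 ≤ ‖ξ‖ * ‖derivAdjoint τ X j ξ (P' * P)‖ := by
  have h := inner_derivAdjoint_mul hX hξ hP.symm 1 P
  rw [mul_one, derivAdjoint_one] at h
  have h2 := norm_inner_le_norm (𝕜 := ℂ) ξ (derivAdjoint τ X j ξ (P' * P))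
  rw [h, inner_self_eq_norm_sq_to_K] at h2
  simpa using h2

variable (τ X) in
theorem exists_norm_sliceRight_le (t : NCPoly n ⊗[ℂ] NCPoly n) :
    ∃ C : ℝ, 0 ≤ C ∧ ∀ d, ‖toL2 τ (ev X (sliceRight τ X d t))‖ ≤ C * ‖toL2 τ d‖ := by
  induction t using TensorProduct.induction_on with
  | zero => exact ⟨0, le_rfl, by simp⟩
  | tmul p q =>
    refine ⟨‖toL2 τ (ev X q)‖ * ‖toL2 τ (ev X p)‖, by positivity, fun d => ?_⟩
    rw [sliceRight_tmul, map_smul, map_smul, norm_smul]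
    nlinarith [norm_trace_mul_le τ (ev X q) d, norm_nonneg (toL2 τ (ev X p))]
  | add a b ha hb =>
    obtain ⟨C, hC, h⟩ := ha
    obtain ⟨C', hC', h'⟩ := hb
    refine ⟨C + C', by positivity, fun d => ?_⟩
    rw [map_add, map_add, map_add]
    nlinarith [norm_add_le (toL2 τ (ev X (sliceRight τ X d a)))
      (toL2 τ (ev X (sliceRight τ X d b))), h d, h' d]

variable (τ X j) in
theorem exists_norm_derivTrace_le (P : NCPoly n) :
    ∃ C : ℝ, 0 ≤ C ∧ ∀ c d, ‖derivTrace τ X j c P d‖ ≤ C * ‖toL2 τ c‖ * ‖toL2 τ d‖ := by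
  obtain ⟨C, hC, h⟩ := exists_norm_sliceRight_le τ X (ncDeriv j P)
  refine ⟨C, hC, fun c d => ?_⟩
  rw [derivTrace_eq_right]
  refine (norm_trace_mul_le τ _ _).trans ?_
  rw [mul_comm C, mul_assoc]
  exact mul_le_mul_of_nonneg_left (h d) (norm_nonneg _)

/-- If `(a k)² ≤ b · a (2 k)` and `a k = O(k ρ ^ k)`, then `a 1 ≤ b ρ`. -/
theorem le_of_sq_le_of_growth {a : ℕ → ℝ} {b C ρ : ℝ} (hb : 0 ≤ b)
    (hρ : 0 < ρ) (h : ∀ k, a k ^ 2 ≤ b * a (2 * k)) (hg : ∀ k, a k ≤ C * (k + 1) * ρ ^ k) :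
    a 1 ≤ b * ρ := by
  -- The ratio `r` below divides by `b`; for `b = 0` the hypothesis at `k = 1` already forces `a 1 =
  -- 0`.
  rcases hb.eq_or_lt with rfl | hb
  · have := h 1
    simp only [zero_mul] at this ⊢
    nlinarith [sq_nonneg (a 1)]
  by_contra! hlt
  set r := a 1 / (b * ρ) with hr
  have hr1 : 1 < r := (one_lt_div (by positivity)).2 hlt
  -- Since `a 1 = b ρ r`, repeated squaring propagates this lower bound along powers of two. For `r
  -- > 1` it outgrows the linear factor allowed by `hg`.
  have key : ∀ k : ℕ, b * ρ ^ (2 ^ k) * r ^ (2 ^ k) ≤ a (2 ^ k) := by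
    intro k
    induction k with
    | zero =>
      simp only [pow_zero, pow_one]
      rw [hr]; field_simp; rfl
    | succ k ih =>
      have h1 := h (2 ^ k)
      have h2 : (b * ρ ^ (2 ^ k) * r ^ (2 ^ k)) ^ 2 ≤ a (2 ^ k) ^ 2 := by gcongr
      have h3 : b * (b * ρ ^ (2 ^ (k + 1)) * r ^ (2 ^ (k + 1))) ≤ b * a (2 * 2 ^ k) := by
        refine le_trans (le_of_eq ?_) (h2.trans h1)
        rw [pow_succ 2 k, pow_mul, pow_mul]; ring
      rw [pow_succ' 2 k] at h3 ⊢
      exact le_of_mul_le_mul_left h3 hb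
  have h4 : ∀ k : ℕ, b * r ^ (2 ^ k) ≤ C * ((2 ^ k : ℕ) + 1) := by
    intro k
    have h5 := (key k).trans (hg (2 ^ k))
    have h6 : 0 < ρ ^ (2 ^ k) := by positivity
    refine le_of_mul_le_mul_right ?_ h6
    linarith
  have hsub : Filter.Tendsto (fun k : ℕ => 2 ^ k) Filter.atTop Filter.atTop :=
    tendsto_pow_atTop_atTop_of_one_lt one_lt_two
  have hlim : Filter.Tendsto (fun m : ℕ => C * ((m : ℝ) / r ^ m + 1 / r ^ m)) Filter.atTop
      (nhds (C * (0 + 0))) := by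
    refine Filter.Tendsto.const_mul _ (Filter.Tendsto.add ?_ ?_)
    · simpa using tendsto_pow_const_div_const_pow_of_one_lt 1 hr1
    · simpa using tendsto_pow_const_div_const_pow_of_one_lt 0 hr1
  have hle := ge_of_tendsto' (hlim.comp hsub) (b := b) fun k => by
    have h7 := h4 k
    have h8 : 0 < r ^ (2 ^ k) := by positivity
    simp only [Function.comp_apply]
    rw [← add_div, mul_div_assoc', le_div_iff₀ h8]
    exact h7
  simp at hle
  linarith

theorem exists_norm_derivAdjoint_pow_le (R : NCPoly n) {ρ : ℝ} (hρ : 0 < ρ) (hR : ‖ev X R‖ ≤ ρ) :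
    ∃ C, ∀ m : ℕ, ‖derivAdjoint τ X j ξ (R ^ m)‖ ≤ C * (m + 1) * ρ ^ m := by
  obtain ⟨C, hC, h⟩ := exists_norm_sliceRight_le τ X (ncDeriv j R)
  -- `‖ξ‖` is the value at `m = 0`; each further factor `R` contributes at most `C ρ ^ m = (C / ρ) ρ
  -- ^ (m + 1)`.
  refine ⟨‖ξ‖ + C / ρ, fun m => ?_⟩
  induction m with
  | zero =>
    rw [pow_zero, derivAdjoint_one]
    have : 0 ≤ C / ρ := by positivity
    simpa using this
  | succ m ih =>
    have hpow : ‖toL2 τ (ev X R ^ m)‖ ≤ ρ ^ m := by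
      clear ih
      induction m with
      | zero => simp [norm_toL2_one]
      | succ m ih =>
        rw [pow_succ', pow_succ']
        exact (norm_toL2_mul_le τ _ _).trans (mul_le_mul hR ih (norm_nonneg _) hρ.le)
    rw [pow_succ', derivAdjoint_mul, map_pow]
    have h1 := norm_leftMul_le τ (ev X R) (derivAdjoint τ X j ξ (R ^ m))
    have h2 : ‖ev X R‖ * ‖derivAdjoint τ X j ξ (R ^ m)‖ ≤
        ρ * ((‖ξ‖ + C / ρ) * (m + 1) * ρ ^ m) := by gcongr
    have h3 : ‖toL2 τ (ev X (derivRight τ X j R (ev X R ^ m)))‖ ≤ C * ρ ^ m :=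
      (h _).trans (by gcongr)
    refine (norm_sub_le _ _).trans ((add_le_add (h1.trans h2) h3).trans ?_)
    have h4 : C * ρ ^ m = (C / ρ) * (ρ * ρ ^ m) := by field_simp
    have h5 : 0 ≤ ‖ξ‖ * (ρ * ρ ^ m) := by positivity
    rw [h4]; push_cast
    rw [pow_succ']; linarith

theorem norm_derivAdjoint_le (hX : ∀ i, IsSelfAdjoint (X i)) (hξ : IsConjugateVariable τ X j ξ)
    (P : NCPoly n) : ‖derivAdjoint τ X j ξ P‖ ≤ ‖ξ‖ * ‖ev X P‖ := by
  obtain ⟨P', hP⟩ := exists_isAdj τ j hX P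
  have hR : IsAdj τ X j (P' * P) (P' * P) := hP.symm.mul hP
  have hnorm : ‖ev X (P' * P)‖ = ‖ev X P‖ ^ 2 := by
    rw [map_mul, hP.1, sq]
    exact CStarRing.norm_star_mul_self (x := ((ev X P : M.toStarSubalgebra) : H →L[ℂ] H))
  -- The growth lemma, applied to the powers of `P' * P`, gives `‖∂*(P'P⊗1)‖ ≤ ‖ξ‖ ρ`. The strict
  -- inequality keeps `ρ` positive when `P(X) = 0`; afterwards `ρ` decreases to `‖P(X)‖²`.
  have h1 : ∀ ρ, ‖ev X P‖ ^ 2 < ρ → ‖derivAdjoint τ X j ξ P‖ ^ 2 ≤ ‖ξ‖ ^ 2 * ρ := by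
    intro ρ hlt
    have hρ : 0 < ρ := lt_of_le_of_lt (by positivity) hlt
    obtain ⟨C, hC⟩ := exists_norm_derivAdjoint_pow_le (τ := τ) (X := X) (j := j) (ξ := ξ)
      (P' * P) hρ (hnorm.trans_le hlt.le)
    have h2 := le_of_sq_le_of_growth (a := fun m => ‖derivAdjoint τ X j ξ ((P' * P) ^ m)‖)
      (b := ‖ξ‖) (norm_nonneg _) hρ
      (fun k => by
        have := norm_derivAdjoint_sq_le hX hξ (hR.pow k)
        rwa [← pow_add, ← two_mul] at this) hC
    rw [pow_one] at h2
    have h3 := norm_derivAdjoint_sq_le hX hξ hP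
    nlinarith [norm_nonneg ξ, mul_le_mul_of_nonneg_left h2 (norm_nonneg ξ)]
  have h4 : ‖derivAdjoint τ X j ξ P‖ ^ 2 ≤ ‖ξ‖ ^ 2 * ‖ev X P‖ ^ 2 := by
    refine ge_of_tendsto (f := fun ρ => ‖ξ‖ ^ 2 * ρ) (x := nhdsWithin (‖ev X P‖ ^ 2) (Set.Ioi _)) ?_
      (Filter.eventually_of_mem self_mem_nhdsWithin h1)
    exact ((continuous_const.mul continuous_id).tendsto _).mono_left nhdsWithin_le_nhds
  rw [← mul_pow] at h4
  exact (sq_le_sq₀ (norm_nonneg _) (by positivity)).1 h4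

theorem norm_derivRight_le (hX : ∀ i, IsSelfAdjoint (X i)) (hξ : IsConjugateVariable τ X j ξ)
    (P : NCPoly n) : ‖toL2 τ (ev X (derivRight τ X j P 1))‖ ≤ 2 * ‖ξ‖ * ‖ev X P‖ := by
  have h1 : toL2 τ (ev X (derivRight τ X j P 1)) =
      leftMul τ (ev X P) ξ - derivAdjoint τ X j ξ P := by rw [derivAdjoint]; abel
  rw [h1]
  linarith [norm_sub_le (leftMul τ (ev X P) ξ) (derivAdjoint τ X j ξ P),
    norm_leftMul_le τ (ev X P) ξ, norm_derivAdjoint_le hX hξ P]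

theorem norm_derivLeft_le (hX : ∀ i, IsSelfAdjoint (X i)) (hξ : IsConjugateVariable τ X j ξ)
    (P : NCPoly n) : ‖toL2 τ (ev X (derivLeft τ X j 1 P))‖ ≤ 2 * ‖ξ‖ * ‖ev X P‖ := by
  obtain ⟨P', hP⟩ := exists_isAdj τ j hX P
  rw [← norm_toL2_star, hP.star_derivLeft, star_one, ← norm_coe_star (ev X P), ← hP.1]
  exact norm_derivRight_le hX hξ P'

/-- The Leibniz expansion of the conjugate relation for `W P U`. The constant 3 is 2 from a slice
bound plus 1 from `τ(ξ W P U)`. -/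
theorem norm_derivTrace_le (hX : ∀ i, IsSelfAdjoint (X i)) (hξ : IsConjugateVariable τ X j ξ)
    (W P U : NCPoly n) :
    ‖derivTrace τ X j (ev X W) P (ev X U)‖ ≤
      3 * ‖ξ‖ * (‖ev X W‖ * ‖toL2 τ (ev X P * ev X U)‖ +
        ‖toL2 τ (ev X W * ev X P)‖ * ‖ev X U‖) := by
  have h1 := hξ.derivTrace_one (W * (P * U))
  rw [derivTrace_mul, derivTrace_mul, one_mul, mul_one, mul_one] at h1
  have h2 : ‖derivTrace τ X j 1 W (ev X (P * U))‖ ≤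
      2 * ‖ξ‖ * ‖ev X W‖ * ‖toL2 τ (ev X P * ev X U)‖ := by
    rw [derivTrace_eq_left, map_mul (ev X)]
    exact (norm_trace_mul_le τ _ _).trans (by gcongr; exact norm_derivLeft_le hX hξ W)
  have h3 : ‖derivTrace τ X j (ev X W * ev X P) U 1‖ ≤
      ‖toL2 τ (ev X W * ev X P)‖ * (2 * ‖ξ‖ * ‖ev X U‖) := by
    rw [derivTrace_eq_right]
    exact (norm_trace_mul_le τ _ _).trans (by gcongr; exact norm_derivRight_le hX hξ U)
  have h4 : ‖⟪toL2 τ (star (ev X (W * (P * U)))), ξ⟫_ℂ‖ ≤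
      ‖ev X W‖ * ‖toL2 τ (ev X P * ev X U)‖ * ‖ξ‖ := by
    refine (norm_inner_le_norm _ _).trans ?_
    rw [norm_toL2_star, map_mul (ev X), map_mul (ev X)]
    gcongr
    exact norm_toL2_mul_le τ _ _
  have h5 : derivTrace τ X j (ev X W) P (ev X U) =
      ⟪toL2 τ (star (ev X (W * (P * U)))), ξ⟫_ℂ - derivTrace τ X j 1 W (ev X (P * U)) -
        derivTrace τ X j (ev X W * ev X P) U 1 := by
    rw [← h1]; ring
  rw [h5]
  have h6 := norm_sub_le (⟪toL2 τ (star (ev X (W * (P * U)))), ξ⟫_ℂ -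
    derivTrace τ X j 1 W (ev X (P * U))) (derivTrace τ X j (ev X W * ev X P) U 1)
  have h7 := norm_sub_le (⟪toL2 τ (star (ev X (W * (P * U)))), ξ⟫_ℂ)
    (derivTrace τ X j 1 W (ev X (P * U)))
  have h8 : 0 ≤ ‖toL2 τ (ev X W * ev X P)‖ * ‖ev X U‖ * ‖ξ‖ := by positivity
  linarith

end ConjugateVariable

/-! ### Amplification to `ℓ²(ι, H)` and the double commutant theorem. -/

section Amplification
variable (ι : Type*)

/-- The amplification of a bounded operator to `ℓ²(ι, H)`. -/
noncomputable def amplification (a : H →L[ℂ] H) :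
    lp (fun _ : ι => H) 2 →L[ℂ] lp (fun _ : ι => H) 2 :=
  lp.mapCLM 2 (fun _ => a) (norm_nonneg a) (fun _ => le_rfl)

variable {ι}

omit [CompleteSpace H] in
theorem amplification_apply (a : H →L[ℂ] H) (z : lp (fun _ : ι => H) 2) (i : ι) :
    amplification ι a z i = a (z i) := rfl

omit [CompleteSpace H] in
theorem amplification_single [DecidableEq ι] (a : H →L[ℂ] H) (i : ι) (h : H) :
    amplification ι a (lp.single 2 i h) = lp.single 2 i (a h) := by
  ext k
  rw [amplification_apply, lp.single_apply, lp.single_apply]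
  by_cases hk : k = i
  · subst hk; simp
  · simp [hk]

theorem inner_amplification_star (a : H →L[ℂ] H) (z w : lp (fun _ : ι => H) 2) :
    ⟪amplification ι (star a) z, w⟫_ℂ = ⟪z, amplification ι a w⟫_ℂ := by
  rw [lp.inner_eq_tsum, lp.inner_eq_tsum]
  refine tsum_congr fun i => ?_
  rw [amplification_apply, amplification_apply, ContinuousLinearMap.star_eq_adjoint,
    ContinuousLinearMap.adjoint_inner_left]

/-- The orbit of a vector of `ℓ²(ι, H)` under the amplification of an algebra of operators. -/
noncomputable def amplificationOrbit (A : StarSubalgebra ℂ (H →L[ℂ] H))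
    (z : lp (fun _ : ι => H) 2) : Submodule ℂ (lp (fun _ : ι => H) 2) where
  carrier := {w | ∃ a ∈ A, amplification ι a z = w}
  add_mem' := by
    rintro _ _ ⟨a, ha, rfl⟩ ⟨b, hb, rfl⟩
    exact ⟨a + b, add_mem ha hb, rfl⟩
  zero_mem' := ⟨0, zero_mem _, rfl⟩
  smul_mem' := by
    rintro c _ ⟨a, ha, rfl⟩
    exact ⟨c • a, SMulMemClass.smul_mem c ha, rfl⟩

/-- The double commutant theorem, for one vector of `ℓ²(ι, H)`. -/
theorem amplification_mem_closure_orbit (A : StarSubalgebra ℂ (H →L[ℂ] H))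
    (z : lp (fun _ : ι => H) 2) {a : H →L[ℂ] H}
    (ha : a ∈ Set.centralizer (Set.centralizer (A : Set (H →L[ℂ] H)))) :
    amplification ι a z ∈ (amplificationOrbit A z).topologicalClosure := by
  classical
  set K := (amplificationOrbit A z).topologicalClosure with hK
  have : CompleteSpace K := (Submodule.isClosed_topologicalClosure _).completeSpace_coe
  have hinv : ∀ p ∈ A, ∀ w ∈ K, amplification ι p w ∈ K := by
    intro p hp w hw
    have h1 : Set.MapsTo (amplification ι p) (amplificationOrbit A z : Set _)
        (amplificationOrbit A z : Set _) := by
      rintro _ ⟨b, hb, rfl⟩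
      exact ⟨p * b, mul_mem hp hb, rfl⟩
    exact h1.closure (amplification ι p).continuous hw
  have hcomm : ∀ p ∈ A, ∀ w, K.starProjection (amplification ι p w) =
      amplification ι p (K.starProjection w) := by
    intro p hp w
    refine Submodule.eq_starProjection_of_mem_of_inner_eq_zero
      (hinv p hp _ (K.starProjection_apply_mem w)) fun v hv => ?_
    rw [← map_sub, ← star_star p, inner_amplification_star]
    exact K.starProjection_inner_eq_zero _ _ (hinv _ (star_mem hp) v hv)
  let entry : ι → ι → (H →L[ℂ] H) := fun i k =>
    lp.evalCLM ℂ (fun _ : ι => H) 2 i ∘L K.starProjection ∘L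
      lp.singleContinuousLinearMap ℂ (fun _ : ι => H) 2 k
  have hentry : ∀ i k, entry i k ∈ Set.centralizer (A : Set (H →L[ℂ] H)) := by
    intro i k p hp
    ext h
    change p ((K.starProjection (lp.single 2 k h) : lp (fun _ : ι => H) 2) i) =
      (K.starProjection (lp.single 2 k (p h)) : lp (fun _ : ι => H) 2) i
    rw [← amplification_single, hcomm p hp]; rfl
  -- The matrix entries of the projection onto `K` lie in the commutant of `A`, hence commute with
  -- `a`; finitely supported vectors are dense.
  have hcomm_a : K.starProjection ∘L amplification ι a = amplification ι a ∘L K.starProjection := by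
    refine lp.ext_continuousLinearMap (by simp) fun k => ?_
    ext h i
    have := congrArg (fun b : H →L[ℂ] H => b h) (ha _ (hentry i k))
    change (K.starProjection (amplification ι a (lp.single 2 k h)) : lp (fun _ : ι => H) 2) i =
      a ((K.starProjection (lp.single 2 k h) : lp (fun _ : ι => H) 2) i)
    rw [amplification_single]
    exact this
  have hz : K.starProjection z = z :=
    Submodule.starProjection_eq_self_iff.2
      ((amplificationOrbit A z).le_topologicalClosure ⟨1, one_mem A, rfl⟩)
  have h := DFunLike.congr_fun hcomm_a z
  change K.starProjection (amplification ι a z) = amplification ι a (K.starProjection z) at h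
  rw [hz] at h
  exact Submodule.starProjection_eq_self_iff.1 h

end Amplification

/-! ### Density of the polynomials in `vN(X)` for `‖·‖₂`. -/

section Density
variable {n : ℕ} (X : Fin n → M.toStarSubalgebra)

/-- The `*`-algebra of bounded operators generated by self-adjoint `X_1, …, X_n`. -/
noncomputable def polyRange (hX : ∀ i, IsSelfAdjoint (X i)) : StarSubalgebra ℂ (H →L[ℂ] H) where
  toSubalgebra := (M.toStarSubalgebra.toSubalgebra.val.comp (ev X)).range
  star_mem' := by
    rintro _ ⟨P, rfl⟩
    obtain ⟨Q, hQ⟩ := exists_ev_eq_star hX P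
    exact ⟨Q, congrArg Subtype.val hQ⟩

variable {X}

theorem vN_subset_centralizer_polyRange (hX : ∀ i, IsSelfAdjoint (X i)) :
    (vN (Set.range fun i => (X i : H →L[ℂ] H)) : Set (H →L[ℂ] H)) ⊆
      Set.centralizer (Set.centralizer (polyRange X hX : Set (H →L[ℂ] H))) := by
  rw [coe_vN]
  refine Set.centralizer_subset (Set.centralizer_subset ?_)
  have h1 : (Set.range fun i => (X i : H →L[ℂ] H)) ⊆ polyRange X hX := by
    rintro _ ⟨i, rfl⟩
    exact ⟨FreeAlgebra.ι ℂ i, congrArg Subtype.val (FreeAlgebra.lift_ι_apply X i)⟩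
  refine Set.union_subset h1 fun x hx => ?_
  rw [← star_star x]
  exact star_mem (h1 hx)

theorem norm_inner_star_mul_le (d : H →L[ℂ] H) (x y : H) :
    ‖⟪x, (star d * d) y⟫_ℂ‖ ≤ ‖d x‖ ^ 2 + ‖d y‖ ^ 2 := by
  have : ⟪x, (star d * d) y⟫_ℂ = ⟪d x, d y⟫_ℂ := by
    rw [ContinuousLinearMap.star_eq_adjoint, mul_apply_eq_comp,
      ContinuousLinearMap.adjoint_inner_right]
  rw [this]
  refine (norm_inner_le_norm _ _).trans ?_
  nlinarith [sq_nonneg (‖d x‖ - ‖d y‖), sq_nonneg ‖d x‖, sq_nonneg ‖d y‖]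

/-- Normality writes `‖d‖₂²` as `∑ₖ ⟨d xₖ, d yₖ⟩`, which is at most `∑ₖ (‖d xₖ‖² + ‖d yₖ‖²)`.
Concatenating the sequences makes this the squared norm of one amplified vector. -/
theorem norm_toL2_le_amplification {z : lp (fun _ : ℕ ⊕ ℕ => H) 2}
    (h : ∀ a : M.toStarSubalgebra,
      HasSum (fun k => ⟪z (.inl k), (a : H →L[ℂ] H) (z (.inr k))⟫_ℂ) (τ.toLin a))
    (d : M.toStarSubalgebra) :
    ‖toL2 τ d‖ ≤ ‖amplification (ℕ ⊕ ℕ) (d : H →L[ℂ] H) z‖ := by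
  have h1 := h (star d * d)
  rw [← norm_toL2_sq] at h1
  have h2 : HasSum (fun i => ‖(d : H →L[ℂ] H) (z i)‖ ^ 2)
      (‖amplification (ℕ ⊕ ℕ) (d : H →L[ℂ] H) z‖ ^ 2) := by
    simpa only [ENNReal.toReal_ofNat, Real.rpow_ofNat, amplification_apply] using
      lp.hasSum_norm (p := 2) (by simp) (amplification (ℕ ⊕ ℕ) (d : H →L[ℂ] H) z)
  have hl := h2.summable.comp_injective (i := Sum.inl) Sum.inl_injective
  have hr := h2.summable.comp_injective (i := Sum.inr) Sum.inr_injective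
  have h3 := (hl.hasSum.sum hr.hasSum).unique h2
  have h5 := tsum_of_norm_bounded (hl.hasSum.add hr.hasSum)
    fun k => norm_inner_star_mul_le (d : H →L[ℂ] H) (z (.inl k)) (z (.inr k))
  have h6 : ∑' k, ⟪z (.inl k), (star (d : H →L[ℂ] H) * (d : H →L[ℂ] H)) (z (.inr k))⟫_ℂ =
    ((‖toL2 τ d‖ ^ 2 : ℝ) : ℂ) := h1.tsum_eq
  rw [h6, h3, Complex.norm_real, Real.norm_of_nonneg (by positivity)] at h5
  exact (sq_le_sq₀ (norm_nonneg _) (norm_nonneg _)).1 h5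

theorem exists_norm_toL2_ev_sub_le (hX : ∀ i, IsSelfAdjoint (X i)) {a : M.toStarSubalgebra}
    (ha : (a : H →L[ℂ] H) ∈ vN (Set.range fun i => (X i : H →L[ℂ] H))) {ε : ℝ} (hε : 0 < ε) :
    ∃ P, ‖toL2 τ (ev X P - a)‖ ≤ ε := by
  obtain ⟨x, y, hx, hy, hxy⟩ := τ.normal
  have hz : Memℓp (Sum.elim x y : ℕ ⊕ ℕ → H) 2 := by
    refine memℓp_gen ?_
    simp only [ENNReal.toReal_ofNat, Real.rpow_ofNat]
    exact (HasSum.sum (f := fun i : ℕ ⊕ ℕ => ‖(Sum.elim x y i : H)‖ ^ 2)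
      hx.hasSum hy.hasSum).summable
  let z : lp (fun _ : ℕ ⊕ ℕ => H) 2 := ⟨_, hz⟩
  have hmem := amplification_mem_closure_orbit (polyRange X hX) z
    (vN_subset_centralizer_polyRange hX ha)
  obtain ⟨_, ⟨_, ⟨P, rfl⟩, rfl⟩, hP⟩ := Metric.mem_closure_iff.1 hmem ε hε
  refine ⟨P, (norm_toL2_le_amplification τ (z := z) hxy (ev X P - a)).trans ?_⟩
  rw [dist_comm, dist_eq_norm] at hP
  exact hP.le

end Density

/-! ### The transform `b ↦ b (1 + b²)⁻¹` on self-adjoint elements. -/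

section BoundedTransform

/-- `(1 + b²)⁻¹` for self-adjoint `b`. -/
noncomputable def resolvSq (b : M.toStarSubalgebra) : M.toStarSubalgebra :=
  ⟨cfc (fun t : ℝ => (1 + t ^ 2)⁻¹) (b : H →L[ℂ] H), cfc_mem_vonNeumannAlgebra M b.2 _⟩

/-- `b (1 + b²)⁻¹` for self-adjoint `b`. -/
noncomputable def bddTransform (b : M.toStarSubalgebra) : M.toStarSubalgebra :=
  ⟨cfc (fun t : ℝ => (1 + t ^ 2)⁻¹ * t) (b : H →L[ℂ] H), cfc_mem_vonNeumannAlgebra M b.2 _⟩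

theorem continuous_inv_one_add_sq : Continuous fun t : ℝ => (1 + t ^ 2)⁻¹ :=
  Continuous.inv₀ (by fun_prop) fun t => by positivity

theorem norm_resolvSq_le (b : M.toStarSubalgebra) : ‖resolvSq b‖ ≤ 1 := by
  refine norm_cfc_le (f := fun t : ℝ => (1 + t ^ 2)⁻¹) (a := (b : H →L[ℂ] H)) zero_le_one
    fun t _ => ?_
  rw [Real.norm_of_nonneg (by positivity)]
  exact inv_le_one_of_one_le₀ (by nlinarith [sq_nonneg t])

theorem norm_bddTransform_le (b : M.toStarSubalgebra) : ‖bddTransform b‖ ≤ 1 := by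
  refine norm_cfc_le (f := fun t : ℝ => (1 + t ^ 2)⁻¹ * t) (a := (b : H →L[ℂ] H)) zero_le_one
    fun t _ => ?_
  rw [norm_mul, Real.norm_of_nonneg (by positivity), inv_mul_le_iff₀ (by positivity), mul_one,
    Real.norm_eq_abs]
  nlinarith [sq_nonneg (|t| - 1), sq_abs t]

variable {b : M.toStarSubalgebra} (hb : IsSelfAdjoint b)
include hb

theorem resolvSq_mul_self : resolvSq b * b = bddTransform b := by
  have hb' : IsSelfAdjoint (b : H →L[ℂ] H) := congrArg Subtype.val hb
  apply Subtype.ext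
  change cfc (fun t : ℝ => (1 + t ^ 2)⁻¹) (b : H →L[ℂ] H) * (b : H →L[ℂ] H) =
    cfc (fun t : ℝ => (1 + t ^ 2)⁻¹ * t) (b : H →L[ℂ] H)
  rw [cfc_mul (fun t : ℝ => (1 + t ^ 2)⁻¹) (fun t => t) (b : H →L[ℂ] H)
    continuous_inv_one_add_sq.continuousOn, cfc_id' ℝ (b : H →L[ℂ] H) hb']

theorem self_mul_resolvSq : b * resolvSq b = bddTransform b := by
  rw [← resolvSq_mul_self hb]
  have hb' : IsSelfAdjoint (b : H →L[ℂ] H) := congrArg Subtype.val hb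
  apply Subtype.ext
  change (b : H →L[ℂ] H) * cfc (fun t : ℝ => (1 + t ^ 2)⁻¹) (b : H →L[ℂ] H) =
    cfc (fun t : ℝ => (1 + t ^ 2)⁻¹) (b : H →L[ℂ] H) * (b : H →L[ℂ] H)
  exact (hb'.commute_cfc (Commute.refl _) _).eq.symm

theorem resolvSq_mul : resolvSq b * (1 + b * b) = 1 := by
  have hb' : IsSelfAdjoint (b : H →L[ℂ] H) := congrArg Subtype.val hb
  rw [mul_add, mul_one, ← mul_assoc, resolvSq_mul_self hb]
  apply Subtype.ext
  change cfc (fun t : ℝ => (1 + t ^ 2)⁻¹) (b : H →L[ℂ] H) +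
    cfc (fun t : ℝ => (1 + t ^ 2)⁻¹ * t) (b : H →L[ℂ] H) * (b : H →L[ℂ] H) = 1
  have h1 : ContinuousOn (fun t : ℝ => (1 + t ^ 2)⁻¹) (spectrum ℝ (b : H →L[ℂ] H)) :=
    continuous_inv_one_add_sq.continuousOn
  nth_rw 3 [← cfc_id' ℝ (b : H →L[ℂ] H) hb']
  rw [← cfc_mul (fun t : ℝ => (1 + t ^ 2)⁻¹ * t) (fun t => t) (b : H →L[ℂ] H)
    (h1.mul continuousOn_id),
    ← cfc_add (a := (b : H →L[ℂ] H)) (fun t : ℝ => (1 + t ^ 2)⁻¹)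
    (fun t => (1 + t ^ 2)⁻¹ * t * t) h1 ((h1.mul continuousOn_id).mul continuousOn_id),
    ← cfc_one ℝ (b : H →L[ℂ] H) hb']
  refine cfc_congr fun t _ => ?_
  have : (1 + t ^ 2) ≠ 0 := by positivity
  simp only [Pi.one_apply]
  field_simp

theorem mul_resolvSq : (1 + b * b) * resolvSq b = 1 := by
  have hcomm : b * resolvSq b = resolvSq b * b := by
    rw [self_mul_resolvSq hb, resolvSq_mul_self hb]
  refine Eq.trans ?_ (resolvSq_mul hb)
  rw [mul_add, add_mul, mul_one, one_mul, mul_assoc, hcomm, ← mul_assoc, hcomm,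
    mul_assoc]

theorem bddTransform_sub {p : M.toStarSubalgebra} (hp : IsSelfAdjoint p) :
    bddTransform p - bddTransform b =
      resolvSq p * (p - b) * resolvSq b - bddTransform p * (p - b) * bddTransform b := by
  have h1 : bddTransform p = resolvSq p * p * ((1 + b * b) * resolvSq b) := by
    rw [mul_resolvSq hb, mul_one, resolvSq_mul_self hp]
  have h2 : bddTransform b = (resolvSq p * (1 + p * p)) * (b * resolvSq b) := by
    rw [resolvSq_mul hp, one_mul, self_mul_resolvSq hb]
  have h3 : bddTransform p - bddTransform b = resolvSq p * p * ((1 + b * b) * resolvSq b) -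
      (resolvSq p * (1 + p * p)) * (b * resolvSq b) := by rw [← h1, ← h2]
  rw [h3, ← resolvSq_mul_self hp, ← self_mul_resolvSq hb]
  noncomm_ring

/-- In `bddTransform_sub` every factor around `p - b` is a contraction. The constant is thus
independent of `‖p‖`, which is uncontrolled for a `‖·‖₂`-approximant. -/
theorem norm_toL2_bddTransform_sub_le {p : M.toStarSubalgebra} (hp : IsSelfAdjoint p) :
    ‖toL2 τ (bddTransform p - bddTransform b)‖ ≤ 2 * ‖toL2 τ (p - b)‖ := by
  have key : ∀ x y : M.toStarSubalgebra, ‖x‖ ≤ 1 → ‖y‖ ≤ 1 →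
      ‖toL2 τ (x * (p - b) * y)‖ ≤ ‖toL2 τ (p - b)‖ := by
    intro x y hx hy
    calc _ ≤ ‖toL2 τ (x * (p - b))‖ * ‖y‖ := norm_toL2_mul_le' τ _ _
      _ ≤ ‖toL2 τ (x * (p - b))‖ := mul_le_of_le_one_right (norm_nonneg _) hy
      _ ≤ ‖x‖ * ‖toL2 τ (p - b)‖ := norm_toL2_mul_le τ _ _
      _ ≤ _ := mul_le_of_le_one_left (norm_nonneg _) hx
  rw [bddTransform_sub hb hp, map_sub]
  refine (norm_sub_le _ _).trans ?_
  rw [two_mul]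
  exact add_le_add (key _ _ (norm_resolvSq_le _) (norm_resolvSq_le _))
    (key _ _ (norm_bddTransform_le _) (norm_bddTransform_le _))

omit hb in
theorem exists_bddTransform_eq (N : VonNeumannAlgebra H) {a : M.toStarSubalgebra}
    (ha : IsSelfAdjoint a) (haN : (a : H →L[ℂ] H) ∈ N) (hnorm : ‖a‖ ≤ 1 / 2) :
    ∃ b : M.toStarSubalgebra, IsSelfAdjoint b ∧ (b : H →L[ℂ] H) ∈ N ∧ bddTransform b = a := by
  have ha' : IsSelfAdjoint (a : H →L[ℂ] H) := congrArg Subtype.val ha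
  -- The smaller root `s` of `s / (1 + s²) = t`, rationalised to avoid dividing by `t`. For `|t| >
  -- 1/2` the square root takes the value 0, so `g` stays continuous on the whole line.
  let g : ℝ → ℝ := fun t => 2 * t / (1 + Real.sqrt (1 - 4 * t ^ 2))
  have hg : Continuous g := by
    refine Continuous.div (by fun_prop) (by fun_prop) fun t => ?_
    have := Real.sqrt_nonneg (1 - 4 * t ^ 2)
    positivity
  refine ⟨⟨cfc g (a : H →L[ℂ] H), cfc_mem_vonNeumannAlgebra M a.2 g⟩,
    Subtype.ext (cfc_predicate g (a : H →L[ℂ] H) : IsSelfAdjoint _).star_eq,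
    cfc_mem_vonNeumannAlgebra N haN g, Subtype.ext ?_⟩
  change cfc (fun t : ℝ => (1 + t ^ 2)⁻¹ * t) (cfc g (a : H →L[ℂ] H)) = a
  rw [← cfc_comp' (fun t : ℝ => (1 + t ^ 2)⁻¹ * t) g (a : H →L[ℂ] H)
    (continuous_inv_one_add_sq.mul continuous_id).continuousOn hg.continuousOn ha']
  refine (cfc_congr fun t ht => ?_).trans (cfc_id' ℝ (a : H →L[ℂ] H) ha')
  have h1 : |t| ≤ 1 / 2 := by
    refine le_trans ?_ hnorm
    refine (spectrum.norm_le_norm_mul_of_mem ht).trans ?_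
    exact mul_le_of_le_one_right (norm_nonneg _) ContinuousLinearMap.norm_id_le
  have h2 : 0 ≤ 1 - 4 * t ^ 2 := by nlinarith [sq_abs t, abs_nonneg t]
  have h3 := Real.sq_sqrt h2
  have h4 := Real.sqrt_nonneg (1 - 4 * t ^ 2)
  simp only [g]
  set w := Real.sqrt (1 - 4 * t ^ 2)
  have h5 : 1 + w ≠ 0 := by positivity
  have h6 : 1 + (2 * t / (1 + w)) ^ 2 = 2 / (1 + w) := by
    field_simp
    nlinarith
  rw [h6]
  field_simp

end BoundedTransform

/-! ### Kaplansky density for `‖·‖₂`. -/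

section BoundedApproximation
variable {n : ℕ} (X : Fin n → M.toStarSubalgebra)

/-- `a` is a limit in `‖·‖₂` of a bounded sequence of polynomials in `X`. -/
def BoundedlyApproximable (a : M.toStarSubalgebra) : Prop :=
  ∃ K : ℝ, 0 ≤ K ∧ ∀ ε : ℝ, 0 < ε → ∃ P, ‖ev X P‖ ≤ K ∧ ‖toL2 τ (ev X P - a)‖ ≤ ε

variable {τ X}

theorem BoundedlyApproximable.add {a b : M.toStarSubalgebra} (ha : BoundedlyApproximable τ X a)
    (hb : BoundedlyApproximable τ X b) : BoundedlyApproximable τ X (a + b) := by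
  obtain ⟨K, hK, ha⟩ := ha
  obtain ⟨L, hL, hb⟩ := hb
  refine ⟨K + L, by positivity, fun ε hε => ?_⟩
  obtain ⟨P, hP, hP'⟩ := ha (ε / 2) (by positivity)
  obtain ⟨Q, hQ, hQ'⟩ := hb (ε / 2) (by positivity)
  refine ⟨P + Q, ?_, ?_⟩
  · rw [map_add]; exact (norm_add_le _ _).trans (add_le_add hP hQ)
  · rw [map_add, add_sub_add_comm, map_add]
    linarith [norm_add_le (toL2 τ (ev X P - a)) (toL2 τ (ev X Q - b))]

theorem BoundedlyApproximable.smul {a : M.toStarSubalgebra} (ha : BoundedlyApproximable τ X a)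
    (c : ℂ) : BoundedlyApproximable τ X (c • a) := by
  obtain ⟨K, hK, ha⟩ := ha
  refine ⟨‖c‖ * K, by positivity, fun ε hε => ?_⟩
  obtain ⟨P, hP, hP'⟩ := ha (ε / (‖c‖ + 1)) (by positivity)
  refine ⟨c • P, ?_, ?_⟩
  · rw [map_smul, norm_smul]; gcongr
  · rw [map_smul, ← smul_sub, map_smul, norm_smul]
    calc ‖c‖ * ‖toL2 τ (ev X P - a)‖ ≤ (‖c‖ + 1) * (ε / (‖c‖ + 1)) := by gcongr; linarith
      _ = ε := by field_simp

variable (τ) in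
theorem exists_isSelfAdjoint_norm_toL2_ev_sub_le (hX : ∀ i, IsSelfAdjoint (X i))
    {a : M.toStarSubalgebra} (hsa : IsSelfAdjoint a)
    (ha : (a : H →L[ℂ] H) ∈ vN (Set.range fun i => (X i : H →L[ℂ] H))) {ε : ℝ} (hε : 0 < ε) :
    ∃ P, IsSelfAdjoint (ev X P) ∧ ‖toL2 τ (ev X P - a)‖ ≤ ε := by
  obtain ⟨P, hP⟩ := exists_norm_toL2_ev_sub_le τ hX ha hε
  obtain ⟨Q, hQ⟩ := exists_ev_eq_star hX P
  refine ⟨(1 / 2 : ℂ) • (P + Q), ?_, ?_⟩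
  · rw [IsSelfAdjoint, map_smul, map_add, hQ, star_smul, star_add, star_star, add_comm]
    simp
  · have h1 : ev X ((1 / 2 : ℂ) • (P + Q)) - a =
        (1 / 2 : ℂ) • ((ev X P - a) + star (ev X P - a)) := by
      rw [star_sub, hsa.star_eq, map_smul, map_add, hQ]
      module
    rw [h1, map_smul, norm_smul, map_add]
    have h2 := norm_add_le (toL2 τ (ev X P - a)) (toL2 τ (star (ev X P - a)))
    rw [norm_toL2_star] at h2
    have h3 : ‖(1 / 2 : ℂ)‖ = 1 / 2 := by norm_num
    rw [h3]
    linarith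

theorem exists_norm_ev_sub_bddTransform_le (hX : ∀ i, IsSelfAdjoint (X i)) (P : NCPoly n) {ε : ℝ}
    (hε : 0 < ε) : ∃ Q, ‖ev X Q - bddTransform (ev X P)‖ ≤ ε := by
  have h1 : ((bddTransform (ev X P) : M.toStarSubalgebra) : H →L[ℂ] H) ∈
      (polyRange X hX).topologicalClosure :=
    cfc_mem (𝕜' := ℂ) (s := (polyRange X hX).topologicalClosure)
      (hs := (polyRange X hX).isClosed_topologicalClosure) _
      ((polyRange X hX).le_topologicalClosure ⟨P, rfl⟩)
  obtain ⟨_, ⟨Q, rfl⟩, hQ⟩ := Metric.mem_closure_iff.1 h1 ε hε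
  rw [dist_comm, dist_eq_norm] at hQ
  exact ⟨Q, hQ.le⟩

theorem boundedlyApproximable_bddTransform (hX : ∀ i, IsSelfAdjoint (X i))
    {b : M.toStarSubalgebra} (hsa : IsSelfAdjoint b)
    (hb : (b : H →L[ℂ] H) ∈ vN (Set.range fun i => (X i : H →L[ℂ] H))) :
    BoundedlyApproximable τ X (bddTransform b) := by
  -- One unit bounds the transform of `P(X)`, the other its norm approximation by a polynomial. The
  -- `ε / 4` below is doubled by the Lipschitz constant.
  refine ⟨2, by norm_num, fun ε hε => ?_⟩
  obtain ⟨P, hP, hPb⟩ := exists_isSelfAdjoint_norm_toL2_ev_sub_le τ hX hsa hb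
    (ε := ε / 4) (by positivity)
  obtain ⟨Q, hQ⟩ := exists_norm_ev_sub_bddTransform_le hX P (ε := min 1 (ε / 2)) (by positivity)
  refine ⟨Q, ?_, ?_⟩
  · have h1 := norm_add_le (ev X Q - bddTransform (ev X P)) (bddTransform (ev X P))
    rw [sub_add_cancel] at h1
    linarith [norm_bddTransform_le (ev X P), hQ.trans (min_le_left _ _)]
  · have h1 : ev X Q - bddTransform b = (ev X Q - bddTransform (ev X P)) +
        (bddTransform (ev X P) - bddTransform b) := by abel
    rw [h1, map_add]
    refine (norm_add_le _ _).trans ?_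
    linarith [norm_toL2_le τ (ev X Q - bddTransform (ev X P)), hQ.trans (min_le_right _ _),
      norm_toL2_bddTransform_sub_le τ hsa hP]

theorem boundedlyApproximable_of_isSelfAdjoint (hX : ∀ i, IsSelfAdjoint (X i))
    {a : M.toStarSubalgebra} (hsa : IsSelfAdjoint a)
    (ha : (a : H →L[ℂ] H) ∈ vN (Set.range fun i => (X i : H →L[ℂ] H))) :
    BoundedlyApproximable τ X a := by
  -- Scaling by `c⁻¹` brings `a` into the ball of radius 1/2, within the range of the transform; the
  -- summand 1 covers `a = 0`.
  set c : ℝ := 2 * ‖a‖ + 1 with hc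
  have hc0 : 0 < c := by positivity
  obtain ⟨b, hb, hbN, hba⟩ := exists_bddTransform_eq
    (vN (Set.range fun i => (X i : H →L[ℂ] H))) (a := ((c⁻¹ : ℝ) : ℂ) • a)
    (by rw [IsSelfAdjoint, star_smul, hsa.star_eq]; simp)
    (SMulMemClass.smul_mem (S := StarSubalgebra ℂ (H →L[ℂ] H))
      (s := (vN (Set.range fun i => (X i : H →L[ℂ] H))).toStarSubalgebra) _ ha)
    (by
      rw [norm_smul, Complex.norm_real, Real.norm_of_nonneg (by positivity),
        inv_mul_le_iff₀ hc0]
      linarith)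
  have h := (boundedlyApproximable_bddTransform (τ := τ) hX hb hbN).smul (c : ℂ)
  rw [hba, smul_smul, ← Complex.ofReal_mul, mul_inv_cancel₀ hc0.ne', Complex.ofReal_one,
    one_smul] at h
  exact h

/-- The Kaplansky density theorem for `vN(X)`, with `‖·‖₂` as the topology. -/
theorem boundedlyApproximable (hX : ∀ i, IsSelfAdjoint (X i)) {a : M.toStarSubalgebra}
    (ha : (a : H →L[ℂ] H) ∈ vN (Set.range fun i => (X i : H →L[ℂ] H))) :
    BoundedlyApproximable τ X a := by
  set N := (vN (Set.range fun i => (X i : H →L[ℂ] H))).toStarSubalgebra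
  have ha' : (a : H →L[ℂ] H) ∈ N := ha
  have h1 : BoundedlyApproximable τ X (a + star a) :=
    boundedlyApproximable_of_isSelfAdjoint hX (IsSelfAdjoint.add_star_self a)
      (add_mem ha' (star_mem ha'))
  have h2 : BoundedlyApproximable τ X (Complex.I • (a - star a)) :=
    boundedlyApproximable_of_isSelfAdjoint hX
      (by
        rw [IsSelfAdjoint, star_smul, star_sub, star_star, Complex.star_def, Complex.conj_I]
        module)
      (SMulMemClass.smul_mem (s := N) Complex.I (sub_mem ha' (star_mem ha')))
  have h3 := (h1.smul (1 / 2)).add (h2.smul (-(Complex.I / 2)))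
  have h4 : a = (1 / 2 : ℂ) • (a + star a) + (-(Complex.I / 2)) • Complex.I • (a - star a) := by
    have h5 : -(Complex.I / 2) * Complex.I = 1 / 2 := by
      linear_combination (-1 / 2 : ℂ) * Complex.I_mul_I
    rw [smul_smul, h5]
    module
  rw [h4]
  exact h3

end BoundedApproximation

/-! ### Vanishing of the traces and separation of tensors. -/

section Vanishing
variable {n : ℕ} {X : Fin n → M.toStarSubalgebra} {j : Fin n} {τ}

theorem derivTrace_eq_zero (hX : ∀ i, IsSelfAdjoint (X i)) {ξ : L2 τ}
    (hξ : IsConjugateVariable τ X j ξ) {P : NCPoly n} {w u : M.toStarSubalgebra}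
    (hw : BoundedlyApproximable τ X w) (hu : BoundedlyApproximable τ X u)
    (hwP : w * ev X P = 0) (hPu : ev X P * u = 0) : derivTrace τ X j w P u = 0 := by
  obtain ⟨K, hK, hw⟩ := hw
  obtain ⟨L, hL, hu⟩ := hu
  obtain ⟨C, hC, hD⟩ := exists_norm_derivTrace_le τ X j P
  set B : ℝ := C * ‖toL2 τ u‖ + C * K + 3 * ‖ξ‖ * (K * ‖ev X P‖ + ‖ev X P‖ * L) with hB
  have hB0 : 0 ≤ B := by positivity
  have key : ∀ ε : ℝ, 0 < ε → ‖derivTrace τ X j w P u‖ ≤ B * ε := by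
    intro ε hε
    obtain ⟨W, hWK, hWw⟩ := hw ε hε
    obtain ⟨U, hUL, hUu⟩ := hu ε hε
    -- The two corrections are small because the trace form is `‖·‖₂`-continuous for fixed `P`. The
    -- main term is small because `P U = P (U - u)` and `W P = (W - w) P`, with `‖W‖ ≤ K` and `‖U‖ ≤
    -- L` independent of `ε`.
    have h1 : derivTrace τ X j w P u = derivTrace τ X j (ev X W) P (ev X U) -
        derivTrace τ X j (ev X W - w) P u - derivTrace τ X j (ev X W) P (ev X U - u) := by
      rw [derivTrace_sub_left, derivTrace_sub_right]; ring
    have h2 : ‖derivTrace τ X j (ev X W - w) P u‖ ≤ C * ε * ‖toL2 τ u‖ :=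
      (hD _ _).trans (by gcongr)
    have h3 : ‖derivTrace τ X j (ev X W) P (ev X U - u)‖ ≤ C * K * ε := by
      refine (hD _ _).trans ?_
      gcongr
      exact (norm_toL2_le τ _).trans hWK
    have h4 : ‖toL2 τ (ev X P * ev X U)‖ ≤ ‖ev X P‖ * ε := by
      have : ev X P * ev X U = ev X P * (ev X U - u) := by rw [mul_sub, hPu, sub_zero]
      rw [this]
      exact (norm_toL2_mul_le τ _ _).trans (by gcongr)
    have h5 : ‖toL2 τ (ev X W * ev X P)‖ ≤ ε * ‖ev X P‖ := by
      have : ev X W * ev X P = (ev X W - w) * ev X P := by rw [sub_mul, hwP, sub_zero]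
      rw [this]
      exact (norm_toL2_mul_le' τ _ _).trans (by gcongr)
    have h6 : ‖derivTrace τ X j (ev X W) P (ev X U)‖ ≤
        3 * ‖ξ‖ * (K * (‖ev X P‖ * ε) + (ε * ‖ev X P‖) * L) :=
      (norm_derivTrace_le hX hξ W P U).trans (by gcongr)
    rw [h1]
    refine (norm_sub_le _ _).trans ((add_le_add_left (norm_sub_le _ _) _).trans ?_)
    rw [hB]
    linarith
  by_contra hne
  have hpos : 0 < ‖derivTrace τ X j w P u‖ := norm_pos_iff.2 hne
  have h := key (‖derivTrace τ X j w P u‖ / (2 * (B + 1))) (by positivity)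
  rw [mul_div_assoc', le_div_iff₀ (by positivity)] at h
  nlinarith

theorem eq_zero_of_forall_rTensor_eq_zero {k V W : Type*} [Field k] [AddCommGroup V] [Module k V]
    [AddCommGroup W] [Module k W] {t : V ⊗[k] W}
    (h : ∀ f : V →ₗ[k] k, TensorProduct.lid k W (LinearMap.rTensor W f t) = 0) : t = 0 := by
  classical
  let b := Module.Basis.ofVectorSpace k V
  refine (TensorProduct.equivFinsuppOfBasisLeft b).map_eq_zero_iff.1 (Finsupp.ext fun i => ?_)
  rw [TensorProduct.equivFinsuppOfBasisLeft_apply]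
  exact h (b.coord i)

variable (X) in
theorem ev_mem (N : StarSubalgebra ℂ (H →L[ℂ] H)) (hN : ∀ i, (X i : H →L[ℂ] H) ∈ N)
    (Q : NCPoly n) : ((ev X Q : M.toStarSubalgebra) : H →L[ℂ] H) ∈ N := by
  induction Q using FreeAlgebra.induction with
  | grade0 r =>
    rw [AlgHom.commutes]
    exact algebraMap_mem N r
  | grade1 i =>
    rw [ev, FreeAlgebra.lift_ι_apply]
    exact hN i
  | mul a b ha hb => rw [map_mul]; exact mul_mem ha hb
  | add a b ha hb => rw [map_add]; exact add_mem ha hb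

variable (X) in
theorem rTensor_ev₂_mem (N : StarSubalgebra ℂ (H →L[ℂ] H)) (hN : ∀ i, (X i : H →L[ℂ] H) ∈ N)
    {u : M.toStarSubalgebra} (hu : (u : H →L[ℂ] H) ∈ N) (f : M.toStarSubalgebra →ₗ[ℂ] ℂ)
    (c : M.toStarSubalgebra) (s : NCPoly n ⊗[ℂ] NCPoly n) :
    ((TensorProduct.lid ℂ _ (LinearMap.rTensor _ f ((c ⊗ₜ[ℂ] 1) * ev₂ X s * (1 ⊗ₜ[ℂ] u))) :
      M.toStarSubalgebra) : H →L[ℂ] H) ∈ N := by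
  induction s using TensorProduct.induction_on with
  | zero => simp
  | tmul p q =>
    rw [ev₂_tmul, Algebra.TensorProduct.tmul_mul_tmul, Algebra.TensorProduct.tmul_mul_tmul,
      one_mul, LinearMap.rTensor_tmul, TensorProduct.lid_tmul]
    exact SMulMemClass.smul_mem (s := N) _ (mul_mem (ev_mem X N hN q) hu)
  | add a b ha hb =>
    simp only [map_add, mul_add, add_mul]
    exact add_mem ha hb

/-- Applying `f` to the first factor and `τ(· d)` to the second can be done in either order. This
reduces arbitrary linear `f` to slices taken with `τ`. -/
theorem trace_rTensor_mul (f : M.toStarSubalgebra →ₗ[ℂ] ℂ) (c u d : M.toStarSubalgebra)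
    (s : NCPoly n ⊗[ℂ] NCPoly n) :
    τ.toLin (TensorProduct.lid ℂ _
      (LinearMap.rTensor _ f ((c ⊗ₜ[ℂ] 1) * ev₂ X s * (1 ⊗ₜ[ℂ] u))) * d) =
      f (c * ev X (sliceRight τ X (u * d) s)) := by
  induction s using TensorProduct.induction_on with
  | zero => simp
  | tmul p q => simp [ev₂_tmul, sliceRight_tmul, mul_assoc, mul_comm]
  | add a b ha hb => simp only [map_add, mul_add, add_mul, ha, hb]

end Vanishing

end FreeProb

/-! ### The main theorem. -/

theorem corollary3p6 {H : Type*} [NormedAddCommGroup H] [InnerProductSpace ℂ H] [CompleteSpace H]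
    (M : VonNeumannAlgebra H) (τ : FreeProb.FaithfulNormalTrace M)
    {n : ℕ} (X : Fin n → M.toStarSubalgebra) (hX : ∀ i, IsSelfAdjoint (X i))
    (hΦ : FreeProb.freeFisherInfo τ X < ⊤) (P : FreeProb.NCPoly n)
    (u v : M.toStarSubalgebra)
    (hu : (u : H →L[ℂ] H) ∈ FreeProb.vN (Set.range fun i => (X i : H →L[ℂ] H)))
    (hv : (v : H →L[ℂ] H) ∈ FreeProb.vN (Set.range fun i => (X i : H →L[ℂ] H)))
    (hPu : FreeProb.ev X P * u = 0) (hPv : star (FreeProb.ev X P) * v = 0) :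
    ∀ i : Fin n,
      (star v ⊗ₜ[ℂ] 1) * FreeProb.ev₂ X (FreeProb.ncDeriv i P) * (1 ⊗ₜ[ℂ] u) = 0 := by
  intro i
  obtain ⟨ξ, hξ⟩ : ∃ ξ, FreeProb.IsConjugateSystem τ X ξ := by
    by_contra h
    rw [FreeProb.freeFisherInfo, dif_neg h] at hΦ
    exact lt_irrefl _ hΦ
  have hξi : FreeProb.IsConjugateVariable τ X i (ξ i) := hξ.1 i
  set N := (FreeProb.vN (Set.range fun i => (X i : H →L[ℂ] H))).toStarSubalgebra with hN
  have hXN : ∀ i, (X i : H →L[ℂ] H) ∈ N := fun i => FreeProb.subset_vN _ ⟨i, rfl⟩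
  have hevN : ∀ Q, ((FreeProb.ev X Q : M.toStarSubalgebra) : H →L[ℂ] H) ∈ N :=
    FreeProb.ev_mem X N hXN
  have hvP : star v * FreeProb.ev X P = 0 := by
    simpa using congrArg star hPv
  have hzero : ∀ d : M.toStarSubalgebra, (d : H →L[ℂ] H) ∈ N →
      star v * FreeProb.ev X (FreeProb.sliceRight τ X (u * d) (FreeProb.ncDeriv i P)) = 0 := by
    intro d hd
    set x := star v * FreeProb.ev X (FreeProb.sliceRight τ X (u * d) (FreeProb.ncDeriv i P))
    have hx : (x : H →L[ℂ] H) ∈ N := mul_mem (star_mem (s := N) hv) (hevN _)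
    refine τ.faithful _ ?_
    -- The choice `w = x* v*` still satisfies `w P(X) = 0`, and turns the vanishing trace into `τ(x*
    -- x) = 0`.
    have h1 := FreeProb.derivTrace_eq_zero hX hξi (P := P) (w := star x * star v) (u := u * d)
      (FreeProb.boundedlyApproximable hX
        (mul_mem (s := N) (star_mem hx) (star_mem (s := N) hv)))
      (FreeProb.boundedlyApproximable hX (mul_mem (s := N) hu hd))
      (by rw [mul_assoc, hvP, mul_zero]) (by rw [← mul_assoc, hPu, zero_mul])
    rwa [FreeProb.derivTrace_eq_right, mul_assoc] at h1
  refine FreeProb.eq_zero_of_forall_rTensor_eq_zero fun f => ?_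
  have hmem := FreeProb.rTensor_ev₂_mem X N hXN hu f (star v) (FreeProb.ncDeriv i P)
  -- Taking `d` to be the adjoint of the sliced element `y`, which lies in `vN(X)`, gives `τ(y y*) =
  -- 0` by `hzero`, and traciality with faithfulness yields `y = 0`.
  have htr := FreeProb.trace_rTensor_mul (τ := τ) (X := X) f (star v) u
    (star (TensorProduct.lid ℂ _ (LinearMap.rTensor _ f
      ((star v ⊗ₜ[ℂ] 1) * FreeProb.ev₂ X (FreeProb.ncDeriv i P) * (1 ⊗ₜ[ℂ] u)))))
    (FreeProb.ncDeriv i P)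
  rw [hzero _ (star_mem (s := N) hmem), map_zero, τ.tracial] at htr
  exact τ.faithful _ htr
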